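/- **Setting.** Let $\Omega=B(0,1)\subset\mathbb R^2$ be the open unit disk, $\vartheta(\varphi)=(\cos\varphi,\sin\varphi)$, $\vartheta(\varphi)^\perp=(-\sin\varphi,\cos\varphi)$, and identify the circle with $[-\pi,\pi[$ (angles modulo $2\pi$). Let $\mathcal A=\mathcal A_1\cup\dots\cup\mathcal A_I\subset[-\pi,\pi[$, $I\ge 1$, where the $\mathcal A_k$ are pairwise disjoint and each $\mathcal A_k$ corresponds modulo $2\pi$ to an open interval $]a_k,b_k[$ with $a_k<b_k\le a_k+2\pi$ ($I=1$ is the case of a single angular interval). Put $\Omega'_{\mathcal A}={]{-1},1[}\times\mathcal A$; functions on $\Omega$ and $\Omega'_{\mathcal A}$ are extended by zero. The limited-angle Radon transform $\mathcal R^{\mathcal A}\colon L^2(\Omega)\to L^2(\Omega'_{\mathcal A})$ is the bounded linear operator $$[\mathcal R^{\mathcal A}f](s,\varphi)=\int_{\mathbb R}f\bigl(s\,\vartheta(\varphi)+t\,\vartheta(\varphi)^\perp\bigr)\,dt ,$$ and $(\mathcal R^{\mathcal A})^*$ denotes its adjoint. **Discretization.** Let $\delta_s,\delta_x>0$ and $P,N,M\in\mathbb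 N$. Put $s_p=\delta_s\bigl(p-\tfrac{P+1}2\bigr)$, $S_p=s_p+[-\tfrac{\delta_s}2,\tfrac{\delta_s}2[$ for $1\le p\le P$, and $x_{ij}=\delta_x\bigl(i-\tfrac{N+1}2,\,j-\tfrac{M+1}2\bigr)$, $X_{ij}=x_{ij}+[-\tfrac{\delta_x}2,\tfrac{\delta_x}2[^2$ for $1\le i\le N$, $1\le j\le M$. It is assumed that $\Omega\subset\bigcup_{i,j}X_{ij}$ and $]{-1},1[\;\subset\bigcup_pS_p$. For each $k$ choose $Q_k\ge2$ angles $a_k=\varphi^k_1<\varphi^k_2<\dots<\varphi^k_{Q_k}=b_k$, put $\varphi^k_0=\varphi^k_1$, $\varphi^k_{Q_k+1}=\varphi^k_{Q_k}$, let $\Phi^k_q=\bigl[\tfrac{\varphi^k_{q-1}+\varphi^k_q}2,\tfrac{\varphi^k_q+\varphi^k_{q+1}}2\bigr[$ (modulo $2\pi$), and $\delta_\varphi=\max_{k}\max_{1\le q\le Q_k}(\varphi^k_{q+1}-\varphi^k_q)$. With $w_{\delta_s}(t)=\max(0,\delta_s-|t|)$ and $f_{ij}=\delta_x^{-2}\int_{X_{ij}}f(x)\,dx$,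 the fully discrete limited-angle Radon transform $\mathcal R_{\delta_s,\delta_\varphi}^{\delta_x}\colon L^2(\Omega)\to L^2(\Omega'_{\mathcal A})$ is $$[\mathcal R_{\delta_s,\delta_\varphi}^{\delta_x}f](s,\varphi)=\frac{\delta_x^2}{\delta_s^2}\sum_{p=1}^P\sum_{k=1}^I\sum_{q=1}^{Q_k}\chi_{S_p}(s)\,\chi_{\Phi^k_q}(\varphi)\sum_{i=1}^N\sum_{j=1}^M w_{\delta_s}\bigl(x_{ij}\cdot\vartheta(\varphi^k_q)-s_p\bigr)f_{ij}.$$ For $g\in L^2(\Omega'_{\mathcal A})$ let $\omega_g(h)=\Bigl(\int_{-\pi}^{\pi}\int_{\mathbb R}|g(s+h,\varphi)-g(s,\varphi)|^2\,ds\,d\varphi\Bigr)^{1/2}$, $h\in\mathbb R$. **Theorem 2.10.** Fix $\mathcal A$ and consider any family of discretizations as above with $\delta_s\to0$. 1. If $\delta_\varphi/\delta_s\to0$ and $\delta_x/\delta_s\to0$, then $\|\mathcal R_{\delta_s,\delta_\varphi}^{\delta_x}-\mathcal R^{\mathcal A}\|\to0$ in the operator norm of bounded linear operators $L^2(\Omega)\to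 L^2(\Omega'_{\mathcal A})$. If $\delta_\varphi=\mathcal O(\delta_s^{1+\epsilon})$ and $\delta_x=\mathcal O(\delta_s^{1+\epsilon})$ for some $0<\epsilon\le\frac12$, then $\|\mathcal R_{\delta_s,\delta_\varphi}^{\delta_x}-\mathcal R^{\mathcal A}\|=\mathcal O(\delta_s^\epsilon)$. 2. Under the same respective conditions, $\|(\mathcal R_{\delta_s,\delta_\varphi}^{\delta_x})^*-(\mathcal R^{\mathcal A})^*\|\to0$, respectively $\|(\mathcal R_{\delta_s,\delta_\varphi}^{\delta_x})^*-(\mathcal R^{\mathcal A})^*\|=\mathcal O(\delta_s^\epsilon)$, in the operator norm of bounded linear operators $L^2(\Omega'_{\mathcal A})\to L^2(\Omega)$. 3. Let $\epsilon>0$, $\delta_\varphi=\mathcal O(\delta_s^{1+\epsilon})$ and $\delta_x=\mathcal O(\delta_s^{1+\epsilon})$. If $f\in L^2(\Omega)$ satisfies $\omega_{\mathcal R^{\mathcal A}f}(h)=\mathcal O(|h|^\epsilon)$ as $h\to0$, then $\|\mathcal R_{\delta_s,\delta_\varphi}^{\delta_x}f-\mathcal R^{\mathcal A}f\|_{L^2(\Omega'_{\mathcal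 A})}=\mathcal O(\delta_s^\epsilon)$. If $g\in L^2(\Omega'_{\mathcal A})$ satisfies $\omega_g(h)=\mathcal O(|h|^\epsilon)$ as $h\to0$, then $\|(\mathcal R_{\delta_s,\delta_\varphi}^{\delta_x})^*g-(\mathcal R^{\mathcal A})^*g\|_{L^2(\Omega)}=\mathcal O(\delta_s^\epsilon)$. -/

import Mathlib

open MeasureTheory Set Filter Topology Asymptotics
open scoped ENNReal

noncomputable section

namespace LimitedAngle

/-! ### Geometry -/

/-- The open Euclidean unit disk in the plane `ℝ × ℝ` (with Lebesgue measure). -/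
def disk : Set (ℝ × ℝ) := {x | x.1 ^ 2 + x.2 ^ 2 < 1}

/-- The inner product of `x` with the direction `ϑ(φ) = (cos φ, sin φ)`. -/
def dotDir (x : ℝ × ℝ) (φ : ℝ) : ℝ := x.1 * Real.cos φ + x.2 * Real.sin φ

/-- The point `s ϑ(φ) + t ϑ(φ)^⊥`, where `ϑ(φ)^⊥ = (-sin φ, cos φ)`. -/
def linePt (s φ t : ℝ) : ℝ × ℝ :=
  (s * Real.cos φ - t * Real.sin φ, s * Real.sin φ + t * Real.cos φ)

/-- The circle is identified with `[-π, π)`. The set `modTwoPi S` consists of the representatives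
in `[-π, π)` of the points of `S ⊆ ℝ` modulo `2π`. -/
def modTwoPi (S : Set ℝ) : Set ℝ :=
  {φ | φ ∈ Ico (-Real.pi) Real.pi ∧ ∃ k : ℤ, φ + 2 * Real.pi * (k : ℝ) ∈ S}

/-- Finitely many (and at least one) open, nonempty intervals `(a i, b i)` modulo `2π`, none of them
covering the whole circle, pairwise disjoint modulo `2π`.
A single open angular interval is the case `I = 1`. -/
structure AngularSet where
  I : ℕ
  I_pos : 0 < I
  a : Fin I → ℝ
  b : Fin I → ℝ
  lt : ∀ i, a i < b i
  le : ∀ i, b i ≤ a i + 2 * Real.pi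
  disj : Pairwise fun i j => Disjoint (modTwoPi (Ioo (a i) (b i))) (modTwoPi (Ioo (a j) (b j)))

/-- The angle set `𝒜 ⊆ [-π, π)`: the union of the given intervals modulo `2π`. -/
def AngularSet.angles (A : AngularSet) : Set ℝ := ⋃ i, modTwoPi (Ioo (A.a i) (A.b i))

/-- The sinogram domain `(-1, 1) × 𝒜`. -/
def AngularSet.sino (A : AngularSet) : Set (ℝ × ℝ) := Ioo (-1) 1 ×ˢ A.angles

/-- `L²` of the unit disk. -/
abbrev L2Disk : Type := Lp ℝ 2 ((volume : Measure (ℝ × ℝ)).restrict disk)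

/-- `L²((-1, 1) × 𝒜)`; a point is a pair `(s, φ)`. -/
abbrev L2Sino (A : AngularSet) : Type := Lp ℝ 2 ((volume : Measure (ℝ × ℝ)).restrict A.sino)

/-! ### The Radon transform -/

/-- The Radon transform of a function on the plane, evaluated at `z = (s, φ)`. -/
def lineIntegral (f : ℝ × ℝ → ℝ) (z : ℝ × ℝ) : ℝ := ∫ t : ℝ, f (linePt z.1 z.2 t)

/-- Extension by zero of an element of `L²` of the unit disk. -/
def extDisk (f : L2Disk) : ℝ × ℝ → ℝ := disk.indicator f

/-- Extension by zero of an element of `L²((-1, 1) × 𝒜)`. -/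
def extSino {A : AngularSet} (g : L2Sino A) : ℝ × ℝ → ℝ := A.sino.indicator g

lemma measurableSet_disk : MeasurableSet disk :=
  measurableSet_lt (by fun_prop) (by fun_prop)

lemma measurableSet_modTwoPi {S : Set ℝ} (hS : MeasurableSet S) :
    MeasurableSet (modTwoPi S) := by
  have : modTwoPi S = Ico (-Real.pi) Real.pi ∩
      ⋃ k : ℤ, (fun φ : ℝ => φ + 2 * Real.pi * (k : ℝ)) ⁻¹' S := by
    ext φ; simp [modTwoPi]
  rw [this]
  exact measurableSet_Ico.inter (MeasurableSet.iUnion fun k => hS.preimage (by fun_prop))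

lemma AngularSet.measurableSet_angles (A : AngularSet) : MeasurableSet A.angles :=
  MeasurableSet.iUnion fun _ => measurableSet_modTwoPi measurableSet_Ioo

lemma AngularSet.measurableSet_sino (A : AngularSet) : MeasurableSet A.sino :=
  measurableSet_Ioo.prod A.measurableSet_angles

lemma AngularSet.angles_subset (A : AngularSet) : A.angles ⊆ Ico (-Real.pi) Real.pi :=
  iUnion_subset fun _ _ h => h.1

instance (A : AngularSet) : IsFiniteMeasure ((volume : Measure (ℝ × ℝ)).restrict A.sino) := by
  refine isFiniteMeasure_restrict.2 ?_
  refine ne_of_lt (lt_of_le_of_lt (measure_mono (prod_mono le_rfl A.angles_subset)) ?_)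
  rw [Measure.volume_eq_prod, Measure.prod_prod]
  simp [ENNReal.mul_lt_top_iff]

lemma disk_subset : disk ⊆ Ioo (-1) 1 ×ˢ Ioo (-1) 1 := by
  intro x hx
  simp only [disk, mem_ofPred_eq] at hx
  refine ⟨⟨?_, ?_⟩, ⟨?_, ?_⟩⟩ <;> nlinarith [sq_nonneg x.1, sq_nonneg x.2]

instance : IsFiniteMeasure ((volume : Measure (ℝ × ℝ)).restrict disk) := by
  refine isFiniteMeasure_restrict.2 ?_
  refine ne_of_lt (lt_of_le_of_lt (measure_mono disk_subset) ?_)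
  rw [Measure.volume_eq_prod, Measure.prod_prod]
  simp [ENNReal.mul_lt_top_iff]

lemma measurable_linePt : Measurable fun q : (ℝ × ℝ) × ℝ => linePt q.1.1 q.1.2 q.2 := by
  unfold linePt; fun_prop

/-- For a fixed angle, `(s, t) ↦ s ϑ + t ϑ^⊥` is a rotation, hence preserves Lebesgue measure. -/
lemma measurePreserving_linePt (φ : ℝ) :
    MeasurePreserving (fun p : ℝ × ℝ => linePt p.1 φ p.2) volume volume := by
  let M : Matrix (Fin 2) (Fin 2) ℝ := !![Real.cos φ, -Real.sin φ; Real.sin φ, Real.cos φ]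
  let L : (ℝ × ℝ) →ₗ[ℝ] ℝ × ℝ :=
    Matrix.toLin (Module.Basis.finTwoProd ℝ) (Module.Basis.finTwoProd ℝ) M
  have hdet : LinearMap.det L = 1 := by
    simp only [L, LinearMap.det_toLin, M, Matrix.det_fin_two_of]
    nlinarith [Real.sin_sq_add_cos_sq φ]
  have hL : (fun p : ℝ × ℝ => linePt p.1 φ p.2) = L := by
    funext p
    simp only [L, M, Matrix.toLin_finTwoProd_apply, linePt]
    ext <;> simp <;> ring
  refine ⟨by unfold linePt; fun_prop, ?_⟩
  rw [hL, Measure.map_linearMap_addHaar_eq_smul_addHaar _ (by rw [hdet]; exact one_ne_zero), hdet]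
  simp

lemma lintegral_linePt_le (A : AngularSet) {G : ℝ × ℝ → ℝ≥0∞} (hG : Measurable G) :
    ∫⁻ z in A.sino, ∫⁻ t : ℝ, G (linePt z.1 z.2 t) ≤
      ENNReal.ofReal (2 * Real.pi) * ∫⁻ x, G x := by
  have hm : Measurable fun q : (ℝ × ℝ) × ℝ => G (linePt q.1.1 q.1.2 q.2) :=
    hG.comp measurable_linePt
  have hsub : A.sino ⊆ univ ×ˢ Ico (-Real.pi) Real.pi :=
    prod_mono (subset_univ _) A.angles_subset
  calc ∫⁻ z in A.sino, ∫⁻ t : ℝ, G (linePt z.1 z.2 t)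
      ≤ ∫⁻ z in univ ×ˢ Ico (-Real.pi) Real.pi, ∫⁻ t : ℝ, G (linePt z.1 z.2 t) :=
        lintegral_mono_set hsub
    _ = ∫⁻ φ in Ico (-Real.pi) Real.pi, ∫⁻ s : ℝ, ∫⁻ t : ℝ, G (linePt s φ t) := by
        rw [Measure.volume_eq_prod, ← Measure.prod_restrict, Measure.restrict_univ,
          lintegral_prod_symm' _ hm.lintegral_prod_right']
    _ = ∫⁻ _φ in Ico (-Real.pi) Real.pi, ∫⁻ x, G x := by
        refine lintegral_congr fun φ => ?_
        have hφ : Measurable fun p : ℝ × ℝ => G (linePt p.1 φ p.2) :=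
          hG.comp (by unfold linePt; fun_prop)
        rw [← (measurePreserving_linePt φ).lintegral_comp hG, Measure.volume_eq_prod,
          lintegral_prod _ hφ.aemeasurable]
    _ = ENNReal.ofReal (2 * Real.pi) * ∫⁻ x, G x := by
        rw [setLIntegral_const, Real.volume_Ico, mul_comm]
        congr 2; ring

lemma measurable_extDisk (f : L2Disk) : Measurable (extDisk f) :=
  (Lp.stronglyMeasurable f).measurable.indicator measurableSet_disk

lemma extDisk_linePt_eq_zero (f : L2Disk) {s φ t : ℝ} (ht : t ∉ Icc (-1 : ℝ) 1) :
    extDisk f (linePt s φ t) = 0 := by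
  refine indicator_of_notMem (fun h => ht ?_) _
  have h1 : (s * Real.cos φ - t * Real.sin φ) ^ 2 + (s * Real.sin φ + t * Real.cos φ) ^ 2 < 1 := h
  have h2 : (s * Real.cos φ - t * Real.sin φ) ^ 2 + (s * Real.sin φ + t * Real.cos φ) ^ 2
      = s ^ 2 + t ^ 2 := by
    linear_combination (s ^ 2 + t ^ 2) * Real.sin_sq_add_cos_sq φ
  constructor <;> nlinarith [sq_nonneg s]

lemma stronglyMeasurable_lineIntegral (f : L2Disk) :
    StronglyMeasurable (lineIntegral (extDisk f)) :=
  StronglyMeasurable.integral_prod_right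
    (((measurable_extDisk f).comp measurable_linePt).stronglyMeasurable)

lemma lintegral_extDisk (f : L2Disk) :
    ∫⁻ x, ‖extDisk f x‖ₑ ^ (2 : ℝ) = ‖f‖ₑ ^ (2 : ℝ) := by
  have h1 : ∀ x, ‖extDisk f x‖ₑ ^ (2 : ℝ) = disk.indicator (fun x => ‖f x‖ₑ ^ (2 : ℝ)) x := by
    intro x
    by_cases hx : x ∈ disk <;> simp [extDisk, hx]
  simp_rw [h1]
  rw [lintegral_indicator measurableSet_disk, Lp.enorm_def,
    eLpNorm_eq_lintegral_rpow_enorm_toReal (by norm_num) (by norm_num)]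
  simp only [ENNReal.toReal_ofNat]
  rw [← ENNReal.rpow_mul]; norm_num

lemma enorm_lineIntegral_le (f : L2Disk) (z : ℝ × ℝ) :
    ‖lineIntegral (extDisk f) z‖ₑ ^ (2 : ℝ) ≤
      2 * ∫⁻ t : ℝ, ‖extDisk f (linePt z.1 z.2 t)‖ₑ ^ (2 : ℝ) := by
  set u : ℝ → ℝ := fun t => extDisk f (linePt z.1 z.2 t) with hu
  have hum : Measurable u :=
    (measurable_extDisk f).comp (by unfold linePt; fun_prop)
  have h1 : ‖lineIntegral (extDisk f) z‖ₑ ≤ ∫⁻ t in Icc (-1 : ℝ) 1, ‖u t‖ₑ := by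
    have : lineIntegral (extDisk f) z = ∫ t in Icc (-1 : ℝ) 1, u t :=
      (setIntegral_eq_integral_of_forall_compl_eq_zero fun t ht =>
        extDisk_linePt_eq_zero f ht).symm
    rw [this]; exact enorm_integral_le_lintegral_enorm _
  have h2 := eLpNorm_le_eLpNorm_mul_rpow_measure_univ (μ := volume.restrict (Icc (-1 : ℝ) 1))
    (f := u) (p := 1) (q := 2) (by norm_num) hum.aestronglyMeasurable
  rw [eLpNorm_one_eq_lintegral_enorm,
    eLpNorm_eq_lintegral_rpow_enorm_toReal (by norm_num) (by norm_num)] at h2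
  simp only [Measure.restrict_apply_univ, Real.volume_Icc, ENNReal.toReal_ofNat,
    ENNReal.toReal_one] at h2
  calc ‖lineIntegral (extDisk f) z‖ₑ ^ (2 : ℝ)
      ≤ ((∫⁻ t in Icc (-1 : ℝ) 1, ‖u t‖ₑ ^ (2 : ℝ)) ^ (1 / (2 : ℝ)) *
          ENNReal.ofReal (1 - -1) ^ (1 / (1 : ℝ) - 1 / 2)) ^ (2 : ℝ) :=
        ENNReal.rpow_le_rpow (h1.trans h2) (by norm_num)
    _ = (∫⁻ t in Icc (-1 : ℝ) 1, ‖u t‖ₑ ^ (2 : ℝ)) * 2 := by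
        rw [ENNReal.mul_rpow_of_nonneg _ _ (by norm_num), ← ENNReal.rpow_mul, ← ENNReal.rpow_mul]
        norm_num
    _ ≤ 2 * ∫⁻ t : ℝ, ‖u t‖ₑ ^ (2 : ℝ) := by
        rw [mul_comm]
        exact mul_le_mul_right (setLIntegral_le_lintegral _ _) _

lemma eLpNorm_lineIntegral_le (A : AngularSet) (f : L2Disk) :
    eLpNorm (lineIntegral (extDisk f)) 2 (volume.restrict A.sino) ≤
      ENNReal.ofReal (4 * Real.pi) ^ (1 / (2 : ℝ)) * ‖f‖ₑ := by
  rw [eLpNorm_eq_lintegral_rpow_enorm_toReal (by norm_num) (by norm_num)]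
  simp only [ENNReal.toReal_ofNat]
  have hG : Measurable fun x => ‖extDisk f x‖ₑ ^ (2 : ℝ) :=
    (measurable_extDisk f).enorm.pow_const _
  have hGm : Measurable fun z : ℝ × ℝ =>
      ∫⁻ t : ℝ, ‖extDisk f (linePt z.1 z.2 t)‖ₑ ^ (2 : ℝ) :=
    (hG.comp measurable_linePt).lintegral_prod_right'
  have key : ∫⁻ z in A.sino, ‖lineIntegral (extDisk f) z‖ₑ ^ (2 : ℝ) ≤
      ENNReal.ofReal (4 * Real.pi) * ‖f‖ₑ ^ (2 : ℝ) := by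
    calc ∫⁻ z in A.sino, ‖lineIntegral (extDisk f) z‖ₑ ^ (2 : ℝ)
        ≤ ∫⁻ z in A.sino, 2 * ∫⁻ t : ℝ, ‖extDisk f (linePt z.1 z.2 t)‖ₑ ^ (2 : ℝ) :=
          lintegral_mono fun z => enorm_lineIntegral_le f z
      _ = 2 * ∫⁻ z in A.sino, ∫⁻ t : ℝ, ‖extDisk f (linePt z.1 z.2 t)‖ₑ ^ (2 : ℝ) :=
          lintegral_const_mul _ hGm
      _ ≤ 2 * (ENNReal.ofReal (2 * Real.pi) * ‖f‖ₑ ^ (2 : ℝ)) := by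
          rw [← lintegral_extDisk]
          exact mul_le_mul_right (lintegral_linePt_le A hG) _
      _ = ENNReal.ofReal (4 * Real.pi) * ‖f‖ₑ ^ (2 : ℝ) := by
          rw [← mul_assoc, show (4 : ℝ) * Real.pi = 2 * (2 * Real.pi) by ring,
            ENNReal.ofReal_mul (p := 2) (by norm_num)]
          norm_num
  calc (∫⁻ z in A.sino, ‖lineIntegral (extDisk f) z‖ₑ ^ (2 : ℝ)) ^ (1 / (2 : ℝ))
      ≤ (ENNReal.ofReal (4 * Real.pi) * ‖f‖ₑ ^ (2 : ℝ)) ^ (1 / (2 : ℝ)) :=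
        ENNReal.rpow_le_rpow key (by norm_num)
    _ = ENNReal.ofReal (4 * Real.pi) ^ (1 / (2 : ℝ)) * ‖f‖ₑ := by
        rw [ENNReal.mul_rpow_of_nonneg _ _ (by norm_num), ← ENNReal.rpow_mul]
        norm_num

lemma memLp_lineIntegral (A : AngularSet) (f : L2Disk) :
    MemLp (lineIntegral (extDisk f)) 2 (volume.restrict A.sino) :=
  ⟨(stronglyMeasurable_lineIntegral f).aestronglyMeasurable,
    (eLpNorm_lineIntegral_le A f).trans_lt
      (ENNReal.mul_lt_top (ENNReal.rpow_lt_top_of_nonneg (by norm_num) ENNReal.ofReal_ne_top)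
        enorm_lt_top)⟩

lemma integrable_extDisk (f : L2Disk) : Integrable (extDisk f) :=
  (integrable_indicator_iff measurableSet_disk).2 ((Lp.memLp f).integrable (by norm_num))

/-- Almost every line integral of an `L²` function on the disk converges absolutely. -/
lemma ae_integrable_line (A : AngularSet) (f : L2Disk) :
    ∀ᵐ z ∂(volume.restrict A.sino), Integrable fun t : ℝ => extDisk f (linePt z.1 z.2 t) := by
  have hG : Measurable fun x => ‖extDisk f x‖ₑ := (measurable_extDisk f).enorm
  have h := lintegral_linePt_le A hG
  have hfin : ENNReal.ofReal (2 * Real.pi) * ∫⁻ x, ‖extDisk f x‖ₑ ≠ ∞ :=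
    ENNReal.mul_ne_top ENNReal.ofReal_ne_top (integrable_extDisk f).2.ne
  have hGm : Measurable fun z : ℝ × ℝ => ∫⁻ t : ℝ, ‖extDisk f (linePt z.1 z.2 t)‖ₑ :=
    (hG.comp measurable_linePt).lintegral_prod_right'
  filter_upwards [ae_lt_top hGm (ne_top_of_le_ne_top hfin h)] with z hz
  exact ⟨((measurable_extDisk f).comp
    (by unfold linePt; fun_prop)).aestronglyMeasurable, hz⟩

/-- A property that holds almost everywhere in the plane holds almost everywhere on almost every
line. -/
lemma ae_line_of_ae (A : AngularSet) {p : ℝ × ℝ → Prop} (h : ∀ᵐ x, p x) :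
    ∀ᵐ z ∂(volume.restrict A.sino), ∀ᵐ t : ℝ, p (linePt z.1 z.2 t) := by
  obtain ⟨N, hN, hNm, hN0⟩ := exists_measurable_superset_of_null (ae_iff.1 h)
  have hG : Measurable (N.indicator (1 : ℝ × ℝ → ℝ≥0∞)) := measurable_one.indicator hNm
  have h0 := lintegral_linePt_le A hG
  rw [lintegral_indicator_one hNm, hN0, mul_zero, nonpos_iff_eq_zero] at h0
  have hm : Measurable fun q : (ℝ × ℝ) × ℝ =>
      N.indicator (1 : ℝ × ℝ → ℝ≥0∞) (linePt q.1.1 q.1.2 q.2) := hG.comp measurable_linePt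
  rw [lintegral_eq_zero_iff hm.lintegral_prod_right'] at h0
  filter_upwards [h0] with z hz
  have hz' := (lintegral_eq_zero_iff (hG.comp (by unfold linePt; fun_prop))).1 hz
  filter_upwards [hz'] with t ht
  by_contra hp
  have : linePt z.1 z.2 t ∈ N := hN hp
  simp [this] at ht

lemma extDisk_add (f g : L2Disk) :
    ∀ᵐ x, extDisk (f + g) x = extDisk f x + extDisk g x := by
  have := (ae_restrict_iff' measurableSet_disk).1 (Lp.coeFn_add f g)
  filter_upwards [this] with x hx
  by_cases h : x ∈ disk
  · simpa [extDisk, h] using hx h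
  · simp [extDisk, h]

lemma extDisk_smul (c : ℝ) (f : L2Disk) :
    ∀ᵐ x, extDisk (c • f) x = c * extDisk f x := by
  have := (ae_restrict_iff' measurableSet_disk).1 (Lp.coeFn_smul c f)
  filter_upwards [this] with x hx
  by_cases h : x ∈ disk
  · simpa [extDisk, h] using hx h
  · simp [extDisk, h]

/-- The limited-angle Radon transform as a bounded operator `L²(B(0,1)) → L²((-1, 1) × 𝒜)`:
the class of `(s, φ) ↦ ∫ f (s ϑ(φ) + t ϑ(φ)^⊥) dt`, with `f` extended by zero. -/
def radon (A : AngularSet) : L2Disk →L[ℝ] L2Sino A :=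
  LinearMap.mkContinuous
    { toFun := fun f => (memLp_lineIntegral A f).toLp (lineIntegral (extDisk f))
      map_add' := by
        intro f g
        rw [← MemLp.toLp_add]
        refine (MemLp.toLp_eq_toLp_iff _ _).2 ?_
        filter_upwards [ae_line_of_ae A (extDisk_add f g), ae_integrable_line A f,
          ae_integrable_line A g] with z hz hf hg
        simp only [lineIntegral, Pi.add_apply]
        rw [integral_congr_ae hz, integral_add hf hg]
      map_smul' := by
        intro c f
        rw [RingHom.id_apply, ← MemLp.toLp_const_smul]
        refine (MemLp.toLp_eq_toLp_iff _ _).2 ?_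
        filter_upwards [ae_line_of_ae A (extDisk_smul c f)] with z hz
        simp only [lineIntegral, Pi.smul_apply, smul_eq_mul]
        rw [integral_congr_ae hz, integral_const_mul] }
    (ENNReal.ofReal (4 * Real.pi) ^ (1 / (2 : ℝ))).toReal
    (by
      intro f
      change ‖(memLp_lineIntegral A f).toLp (lineIntegral (extDisk f))‖ ≤ _
      rw [Lp.norm_toLp, ← toReal_enorm f, ← ENNReal.toReal_mul]
      exact ENNReal.toReal_mono
        (ENNReal.mul_ne_top (ENNReal.rpow_ne_top_of_nonneg (by norm_num) ENNReal.ofReal_ne_top)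
          enorm_ne_top) (eLpNorm_lineIntegral_le A f))

lemma radon_coeFn (A : AngularSet) (f : L2Disk) :
    radon A f =ᵐ[volume.restrict A.sino] lineIntegral (extDisk f) :=
  (memLp_lineIntegral A f).coeFn_toLp

/-! ### Discretization -/

/-- The `i`-th point `δ (i - (n + 1)/2)` of the centred equispaced grid with `n` points
(`i = 1, …, n`) and width `δ`. -/
def gridPt (δ : ℝ) (n i : ℕ) : ℝ := δ * ((i : ℝ) - ((n : ℝ) + 1) / 2)

/-- The half-open interval of length `δ` centred at the `i`-th grid point. -/
def cell (δ : ℝ) (n i : ℕ) : Set ℝ := Ico (gridPt δ n i - δ / 2) (gridPt δ n i + δ / 2)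

/-- Discretization parameters for the image, the detector and the angle set `𝒜`, compatible with
the unit disk and with the detector interval `(-1, 1)`.
All indices are one-based: `i ∈ {1, …, N}`, `j ∈ {1, …, M}`, `p ∈ {1, …, P}`, and, on the `k`-th
angular interval, `q ∈ {1, …, Q k}`. The angles are `φ k q` for `0 ≤ q ≤ Q k + 1` (other values of
`φ k` play no role), with `φ k 0 = φ k 1` and `φ k (Q k) = φ k (Q k + 1)`. -/
structure Discretization (A : AngularSet) where
  /-- detector width -/
  δs : ℝ
  /-- image pixel size -/
  δx : ℝ
  δs_pos : 0 < δs
  δx_pos : 0 < δx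
  /-- number of detector offsets -/
  P : ℕ
  /-- the image has `N × M` pixels -/
  N : ℕ
  M : ℕ
  /-- number of angles on each of the angular intervals -/
  Q : Fin A.I → ℕ
  φ : Fin A.I → ℕ → ℝ
  Q_two : ∀ k, 2 ≤ Q k
  φ_mono : ∀ k, StrictMonoOn (φ k) (Icc 1 (Q k))
  φ_first : ∀ k, φ k 1 = A.a k
  φ_last : ∀ k, φ k (Q k) = A.b k
  φ_zero : ∀ k, φ k 0 = φ k 1
  φ_succ : ∀ k, φ k (Q k + 1) = φ k (Q k)
  /-- the unit disk is contained in the union of the image pixels -/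
  disk_cover : disk ⊆ ⋃ i ∈ Finset.Icc 1 N, ⋃ j ∈ Finset.Icc 1 M, cell δx N i ×ˢ cell δx M j
  /-- the interval `(-1, 1)` is contained in the union of the detector pixels -/
  offset_cover : Ioo (-1) 1 ⊆ ⋃ p ∈ Finset.Icc 1 P, cell δs P p

/-- The hat function `w_δ(t) = max(0, δ - |t|)`. -/
def hat (δ t : ℝ) : ℝ := max 0 (δ - |t|)

namespace Discretization

variable {A : AngularSet} (D : Discretization A)

/-- The pixel centre `x_{ij}`. -/
def center (i j : ℕ) : ℝ × ℝ := (gridPt D.δx D.N i, gridPt D.δx D.M j)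

/-- The image pixel `X_{ij} = x_{ij} + [-δ_x/2, δ_x/2)²`. -/
def pixel (i j : ℕ) : Set (ℝ × ℝ) := cell D.δx D.N i ×ˢ cell D.δx D.M j

/-- The detector offset `s_p`. -/
def offset (p : ℕ) : ℝ := gridPt D.δs D.P p

/-- The detector pixel `S_p = s_p + [-δ_s/2, δ_s/2)`. -/
def detector (p : ℕ) : Set ℝ := cell D.δs D.P p

/-- The angular pixel `Φ_q = [(φ_{q-1} + φ_q)/2, (φ_q + φ_{q+1})/2)`, modulo `2π`, belonging to the
`k`-th angular interval. -/
def angPixel (k : Fin A.I) (q : ℕ) : Set ℝ :=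
  modTwoPi (Ico ((D.φ k (q - 1) + D.φ k q) / 2) ((D.φ k q + D.φ k (q + 1)) / 2))

/-- The angular discretization width `δ_φ`: the maximum of `φ_{q+1} - φ_q` over `1 ≤ q ≤ Q` and over
all the angular intervals. -/
def δφ : ℝ := ⨆ k : Fin A.I, ⨆ q : Fin (D.Q k), (D.φ k (q + 2) - D.φ k (q + 1))

lemma measurableSet_pixel (i j : ℕ) : MeasurableSet (D.pixel i j) :=
  measurableSet_Ico.prod measurableSet_Ico

lemma measurableSet_sinoPixel (p : ℕ) (k : Fin A.I) (q : ℕ) :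
    MeasurableSet (D.detector p ×ˢ D.angPixel k q) :=
  measurableSet_Ico.prod (measurableSet_modTwoPi measurableSet_Ico)

/-- The pixel mean `f ↦ f_{ij} = δ_x⁻² ∫_{X_{ij}} f`, with `f` extended by zero. -/
def pixelMean (i j : ℕ) : L2Disk →L[ℝ] ℝ :=
  (1 / D.δx ^ 2) • innerSL ℝ (indicatorConstLp 2 (D.measurableSet_pixel i j)
    (measure_ne_top ((volume : Measure (ℝ × ℝ)).restrict disk) _) (1 : ℝ))

lemma pixelMean_apply (i j : ℕ) (f : L2Disk) :
    D.pixelMean i j f = 1 / D.δx ^ 2 * ∫ x in D.pixel i j, extDisk f x := by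
  have h : inner ℝ (indicatorConstLp 2 (D.measurableSet_pixel i j)
      (measure_ne_top ((volume : Measure (ℝ × ℝ)).restrict disk) _) (1 : ℝ)) f
      = ∫ x in D.pixel i j, extDisk f x := by
    rw [L2.inner_indicatorConstLp_one, extDisk, integral_indicator measurableSet_disk,
      Measure.restrict_restrict (D.measurableSet_pixel i j),
      Measure.restrict_restrict measurableSet_disk, inter_comm]
  simp only [pixelMean, smul_apply, innerSL_apply_apply, h, smul_eq_mul]

/-- The characteristic function of the sinogram pixel `S_p × Φ_q`, in `L²((-1, 1) × 𝒜)`. -/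
def sinoPixel (p : ℕ) (k : Fin A.I) (q : ℕ) : L2Sino A :=
  indicatorConstLp 2 (D.measurableSet_sinoPixel p k q)
    (measure_ne_top ((volume : Measure (ℝ × ℝ)).restrict A.sino) _) (1 : ℝ)

/-- The fully discrete (pixel-driven) limited-angle Radon transform,
`(δ_x² / δ_s²) ∑_{p,q} χ_{S_p}(s) χ_{Φ_q}(φ) ∑_{i,j} w_{δ_s}(x_{ij} · ϑ(φ_q) - s_p) f_{ij}`. -/
def radon : L2Disk →L[ℝ] L2Sino A :=
  (D.δx ^ 2 / D.δs ^ 2) • ∑ p ∈ Finset.Icc 1 D.P, ∑ k : Fin A.I, ∑ q ∈ Finset.Icc 1 (D.Q k),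
    (∑ i ∈ Finset.Icc 1 D.N, ∑ j ∈ Finset.Icc 1 D.M,
      hat D.δs (dotDir (D.center i j) (D.φ k q) - D.offset p) • D.pixelMean i j).smulRight
        (D.sinoPixel p k q)

lemma radon_coeFn (f : L2Disk) :
    D.radon f =ᵐ[volume.restrict A.sino] fun z => D.δx ^ 2 / D.δs ^ 2 *
      ∑ p ∈ Finset.Icc 1 D.P, ∑ k : Fin A.I, ∑ q ∈ Finset.Icc 1 (D.Q k),
        (D.detector p ×ˢ D.angPixel k q).indicator 1 z *
          ∑ i ∈ Finset.Icc 1 D.N, ∑ j ∈ Finset.Icc 1 D.M,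
            hat D.δs (dotDir (D.center i j) (D.φ k q) - D.offset p) *
              (1 / D.δx ^ 2 * ∫ x in D.pixel i j, extDisk f x) := by
  simp only [radon, smul_apply, sum_apply, ContinuousLinearMap.smulRight_apply,
    pixelMean_apply, smul_eq_mul]
  refine (Lp.coeFn_smul _ _).trans ?_
  have h1 : ∀ᵐ z ∂(volume.restrict A.sino), ∀ p k q,
      D.sinoPixel p k q z = (D.detector p ×ˢ D.angPixel k q).indicator 1 z :=
    ae_all_iff.2 fun p => ae_all_iff.2 fun k => ae_all_iff.2 fun q => indicatorConstLp_coeFn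
  have h2 : ∀ᵐ z ∂(volume.restrict A.sino), ∀ (p : ℕ) k q,
      ((∑ i ∈ Finset.Icc 1 D.N, ∑ j ∈ Finset.Icc 1 D.M,
        hat D.δs (dotDir (D.center i j) (D.φ k q) - D.offset p) *
          (1 / D.δx ^ 2 * ∫ x in D.pixel i j, extDisk f x)) • D.sinoPixel p k q : L2Sino A) z =
      (∑ i ∈ Finset.Icc 1 D.N, ∑ j ∈ Finset.Icc 1 D.M,
        hat D.δs (dotDir (D.center i j) (D.φ k q) - D.offset p) *
          (1 / D.δx ^ 2 * ∫ x in D.pixel i j, extDisk f x)) * D.sinoPixel p k q z :=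
    ae_all_iff.2 fun p => ae_all_iff.2 fun k => ae_all_iff.2 fun q => Lp.coeFn_smul _ _
  have hsum : ∀ {ι : Type} (s : Finset ι) (g : ι → L2Sino A),
      ∀ᵐ z ∂(volume.restrict A.sino), (∑ i ∈ s, g i : L2Sino A) z = ∑ i ∈ s, g i z := by
    intro ι s g
    filter_upwards [Lp.coeFn_finsetSum s g] with z hz
    simpa using hz
  have h3 := hsum (Finset.Icc 1 D.P) fun p => ∑ k : Fin A.I, ∑ q ∈ Finset.Icc 1 (D.Q k),
    (∑ i ∈ Finset.Icc 1 D.N, ∑ j ∈ Finset.Icc 1 D.M,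
        hat D.δs (dotDir (D.center i j) (D.φ k q) - D.offset p) *
          (1 / D.δx ^ 2 * ∫ x in D.pixel i j, extDisk f x)) • D.sinoPixel p k q
  have h4 := ae_all_iff.2 fun p : ℕ => hsum Finset.univ fun k : Fin A.I =>
    ∑ q ∈ Finset.Icc 1 (D.Q k),
    (∑ i ∈ Finset.Icc 1 D.N, ∑ j ∈ Finset.Icc 1 D.M,
        hat D.δs (dotDir (D.center i j) (D.φ k q) - D.offset p) *
          (1 / D.δx ^ 2 * ∫ x in D.pixel i j, extDisk f x)) • D.sinoPixel p k q
  have h5 := ae_all_iff.2 fun p : ℕ => ae_all_iff.2 fun k : Fin A.I =>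
    hsum (Finset.Icc 1 (D.Q k)) fun q =>
    (∑ i ∈ Finset.Icc 1 D.N, ∑ j ∈ Finset.Icc 1 D.M,
        hat D.δs (dotDir (D.center i j) (D.φ k q) - D.offset p) *
          (1 / D.δx ^ 2 * ∫ x in D.pixel i j, extDisk f x)) • D.sinoPixel p k q
  filter_upwards [h1, h2, h3, h4, h5] with z h1 h2 h3 h4 h5
  simp only [Pi.smul_apply, smul_eq_mul]
  rw [h3]
  congr 1
  refine Finset.sum_congr rfl fun p _ => ?_
  rw [h4]
  refine Finset.sum_congr rfl fun k _ => ?_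
  rw [h5]
  refine Finset.sum_congr rfl fun q _ => ?_
  rw [h2, h1, mul_comm]

end Discretization

/-! ### Regularity -/

/-- The `L²` modulus of continuity `ω_g(h, 0)` in the offset variable of `g`, extended by zero to
`ℝ × [-π, π)`. -/
def modulus {A : AngularSet} (g : L2Sino A) (h : ℝ) : ℝ :=
  √(∫ φ in Ico (-Real.pi) Real.pi, ∫ s : ℝ, (extSino g (s + h, φ) - extSino g (s, φ)) ^ 2)

end LimitedAngle

end

noncomputable section

namespace LimitedAngle

/-! ### Half a derivative of smoothing -/

/-! The error splits into a consistency error and an averaging error. On a sinogram pixel the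
discrete transform is `δs⁻²` times the integral of `f` against a step function with the values `hat
δs (x_ij · ϑ(φ_q) - s_p)`. Replacing the pixel centre by the point `x` and `φ_q` by the actual angle
moves the argument of the hat by at most `δx + δφ`. The hat is 1-Lipschitz and supported in a strip
of width comparable to `δs`, so this costs `O((δx + δφ) / δs) ‖f‖` in `L²`
(`norm_radon_sub_sub_averageError_le`).

After the replacement, integration along lines gives `∫ κ(s, t) Rf(t, φ) dt`, with `κ` the
normalised hat centred at the detector pixel of `s` (`integral_gridKernel_lineIntegral`). This
kernel has height at most `1/δs`, lives near the diagonal and integrates to one in each variable.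
Hence Cauchy–Schwarz bounds the `L²` distance between the average and `Rf` by four times the largest
offset modulus of `Rf` over shifts of size at most `2 δs` (`lintegral_averageDefect_le`). An assumed
modulus of order `ε` therefore gives the rate for an individual `f` directly.

The operator norm needs a modulus bound uniform in `f`. By the Fourier slice theorem, the
one-dimensional transform of an offset profile is the plane transform of `f` on a line through the
origin. The shift multiplier satisfies `|e^{2πihσ} - 1|² ≤ 4π |h| |σ|`, the factor `|σ|` is the
polar Jacobian, and Plancherel bounds the modulus by `√(8π|h|) ‖f‖` (`modulus_radon_le`). This half
derivative is the source of the restriction `ε ≤ 1/2`.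

In operator norm, the adjoint statements hold because taking adjoints is isometric. For a single
`g`, double stochasticity lets the averaging defect be moved from `Rf` to `g` by Fubini
(`integral_mul_averageDefect`), so the regularity of `g` controls it instead. -/

open FourierTransform SchwartzMap in
/-- Plancherel's theorem for the Fourier integral of a function in `L¹ ∩ L²`. -/
lemma lintegral_enorm_fourier_sq {E : Type*} [NormedAddCommGroup E] [MeasurableSpace E]
    [BorelSpace E] [InnerProductSpace ℝ E] [FiniteDimensional ℝ E] {f : E → ℂ}
    (h1 : Integrable f) (h2 : MemLp f 2) :
    ∫⁻ x, ‖𝓕 f x‖ₑ ^ 2 = ∫⁻ x, ‖f x‖ₑ ^ 2 := by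
  set g : Lp ℂ 2 (volume : Measure E) := h2.toLp f with hg
  have hnorm : ∀ g : Lp ℂ 2 (volume : Measure E), ∫⁻ x, ‖g x‖ₑ ^ 2 = ‖g‖ₑ ^ 2 := by
    intro g
    rw [Lp.enorm_def, eLpNorm_eq_lintegral_rpow_enorm_toReal (by norm_num) (by norm_num),
      ← ENNReal.rpow_natCast, ← ENNReal.rpow_mul]
    simp
  have hcont : Continuous (𝓕 f) :=
    VectorFourier.fourierIntegral_continuous Real.continuous_fourierChar
      (by exact continuous_inner) h1
  have hae : (𝓕 g : Lp ℂ 2 (volume : Measure E)) =ᵐ[volume] 𝓕 f := by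
    -- Both sides are tested against a smooth compactly supported `ρ`, seen as a Schwartz function.
    -- The distributional transform puts the Fourier transform on the test function, and the
    -- multiplication formula for integrable functions puts it back on `f`.
    refine ae_eq_of_integral_contDiff_smul_eq ((Lp.memLp _).locallyIntegrable (by norm_num))
      hcont.locallyIntegrable fun ρ hρ hρc => ?_
    have hc : HasCompactSupport (Complex.ofRealCLM ∘ ρ) := hρc.comp_left rfl
    have hd : ContDiff ℝ ((⊤ : ℕ∞) : WithTop ℕ∞) (Complex.ofRealCLM ∘ ρ) :=
      Complex.ofRealCLM.contDiff.comp hρ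
    let ψ : 𝓢(E, ℂ) := hc.toSchwartzMap hd
    have hψ : ∀ x, ψ x = (ρ x : ℂ) := fun x => rfl
    have key := congrArg (fun T : 𝓢'(E, ℂ) => T ψ) (Lp.fourier_toTemperedDistribution_eq g)
    simp only [TemperedDistribution.fourier_apply, Lp.toTemperedDistribution_apply] at key
    have hflip := VectorFourier.integral_fourierIntegral_smul_eq_flip (e := Real.fourierChar)
      (L := innerₗ E) (μ := volume) (ν := volume) (f := ψ) (g := f)
      Real.continuous_fourierChar (by exact continuous_inner) ψ.integrable h1
    rw [flip_innerₗ] at hflip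
    calc ∫ x, ρ x • (𝓕 g : Lp ℂ 2 (volume : Measure E)) x
        = ∫ x, ψ x • (𝓕 g : Lp ℂ 2 (volume : Measure E)) x := by
          refine integral_congr_ae (.of_forall fun x => ?_)
          simp [hψ]
      _ = ∫ x, (𝓕 ψ : 𝓢(E, ℂ)) x • g x := key.symm
      _ = ∫ x, (𝓕 ψ : 𝓢(E, ℂ)) x • f x := by
          refine integral_congr_ae ?_
          filter_upwards [h2.coeFn_toLp] with x hx
          rw [hg, hx]
      _ = ∫ x, ψ x • 𝓕 f x := hflip
      _ = ∫ x, ρ x • 𝓕 f x := by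
          refine integral_congr_ae (.of_forall fun x => ?_)
          simp [hψ]
  calc ∫⁻ x, ‖𝓕 f x‖ₑ ^ 2 = ∫⁻ x, ‖(𝓕 g : Lp ℂ 2 (volume : Measure E)) x‖ₑ ^ 2 := by
        refine lintegral_congr_ae ?_
        filter_upwards [hae] with x hx
        rw [hx]
    _ = ∫⁻ x, ‖g x‖ₑ ^ 2 := by
        rw [hnorm, hnorm, enorm_eq_iff_norm_eq.2 (Lp.norm_fourier_eq g)]
    _ = ∫⁻ x, ‖f x‖ₑ ^ 2 := by
        refine lintegral_congr_ae ?_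
        filter_upwards [h2.coeFn_toLp] with x hx
        rw [hg, hx]

/-- For every angle, the offset profile of the Radon transform is integrable. -/
lemma integrable_extDisk_linePt (f : L2Disk) (φ : ℝ) :
    Integrable fun p : ℝ × ℝ => extDisk f (linePt p.1 φ p.2) :=
  (measurePreserving_linePt φ).integrable_comp_of_integrable (integrable_extDisk f)

lemma integrable_lineIntegral (f : L2Disk) (φ : ℝ) :
    Integrable fun s : ℝ => lineIntegral (extDisk f) (s, φ) :=
  (integrable_extDisk_linePt f φ).integral_prod_left

lemma lintegral_extDisk_sq (f : L2Disk) : ∫⁻ x, ‖extDisk f x‖ₑ ^ 2 = ‖f‖ₑ ^ 2 := by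
  simpa using lintegral_extDisk f

/-- Chords of the disk have length at most 2, which is the Cauchy–Schwarz constant, and rotations
preserve area. The bound holds for every angle, so Plancherel applies to each offset profile. -/
lemma lintegral_lineIntegral_sq_le (f : L2Disk) (φ : ℝ) :
    ∫⁻ s, ‖lineIntegral (extDisk f) (s, φ)‖ₑ ^ 2 ≤ 2 * ‖f‖ₑ ^ 2 := by
  have hG : Measurable fun x => ‖extDisk f x‖ₑ ^ 2 := (measurable_extDisk f).enorm.pow_const _
  have hφ : Measurable fun p : ℝ × ℝ => ‖extDisk f (linePt p.1 φ p.2)‖ₑ ^ 2 :=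
    hG.comp (by unfold linePt; fun_prop)
  calc ∫⁻ s, ‖lineIntegral (extDisk f) (s, φ)‖ₑ ^ 2
      ≤ ∫⁻ s, 2 * ∫⁻ t, ‖extDisk f (linePt s φ t)‖ₑ ^ 2 :=
        lintegral_mono fun s => by simpa using enorm_lineIntegral_le f (s, φ)
    _ = 2 * ∫⁻ s, ∫⁻ t, ‖extDisk f (linePt s φ t)‖ₑ ^ 2 :=
        lintegral_const_mul _ hφ.lintegral_prod_right'
    _ = 2 * ‖f‖ₑ ^ 2 := by
        rw [← lintegral_extDisk_sq, ← (measurePreserving_linePt φ).lintegral_comp hG,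
          Measure.volume_eq_prod, lintegral_prod _ hφ.aemeasurable]

lemma memLp_lineIntegral_offset (f : L2Disk) (φ : ℝ) :
    MemLp (fun s : ℝ => lineIntegral (extDisk f) (s, φ)) 2 := by
  refine ⟨(integrable_lineIntegral f φ).1, ?_⟩
  rw [eLpNorm_lt_top_iff_lintegral_rpow_enorm_lt_top (by norm_num) (by norm_num)]
  simpa using (lintegral_lineIntegral_sq_le f φ).trans_lt
    (ENNReal.mul_lt_top (by norm_num) (by finiteness))

/-- The extension by zero of `f`, as a complex-valued function on `ℂ`. -/
def complexExt (f : L2Disk) (z : ℂ) : ℂ := extDisk f (z.re, z.im)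

lemma integrable_complexExt (f : L2Disk) : Integrable (complexExt f) :=
  (Complex.volume_preserving_equiv_real_prod.integrable_comp_of_integrable
    (integrable_extDisk f)).ofReal

lemma lintegral_complexExt_sq (f : L2Disk) : ∫⁻ z, ‖complexExt f z‖ₑ ^ 2 = ‖f‖ₑ ^ 2 := by
  rw [← lintegral_extDisk_sq, ← Complex.volume_preserving_equiv_real_prod.lintegral_comp
    ((measurable_extDisk f).enorm.pow_const 2)]
  refine lintegral_congr fun z => ?_
  simp only [complexExt, ← ofReal_norm, Complex.norm_real]
  rfl

lemma memLp_complexExt (f : L2Disk) : MemLp (complexExt f) 2 := by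
  refine ⟨(integrable_complexExt f).1, ?_⟩
  rw [eLpNorm_lt_top_iff_lintegral_rpow_enorm_lt_top (by norm_num) (by norm_num)]
  have := lintegral_complexExt_sq f
  simp only [ENNReal.toReal_ofNat, ENNReal.rpow_ofNat, this]
  finiteness

open FourierTransform in
/-- The Fourier slice theorem. -/
lemma fourier_lineIntegral (f : L2Disk) (φ σ : ℝ) :
    𝓕 (fun s : ℝ => (lineIntegral (extDisk f) (s, φ) : ℂ)) σ =
      𝓕 (complexExt f) (σ * (Real.cos φ + Real.sin φ * Complex.I)) := by
  rw [Real.fourier_eq, Real.fourier_eq]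
  have hL : ∀ s : ℝ, Real.fourierChar (-inner ℝ s σ) • (lineIntegral (extDisk f) (s, φ) : ℂ) =
      ∫ t : ℝ, Real.fourierChar (-(s * σ)) • (extDisk f (linePt s φ t) : ℂ) := by
    intro s
    simp_rw [Circle.smul_def, smul_eq_mul]
    rw [integral_const_mul, integral_complex_ofReal]
    simp [lineIntegral, mul_comm]
  simp_rw [hL]
  have hint : Integrable fun p : ℝ × ℝ =>
      Real.fourierChar (-(p.1 * σ)) • (extDisk f (linePt p.1 φ p.2) : ℂ) := by
    refine ((integrable_extDisk_linePt f φ).ofReal (𝕜 := ℂ)).mono ?_ (.of_forall fun p => by simp)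
    refine AEStronglyMeasurable.fun_smul (Continuous.aestronglyMeasurable ?_)
      ((integrable_extDisk_linePt f φ).ofReal (𝕜 := ℂ)).1
    exact Real.continuous_fourierChar.comp (by fun_prop)
  rw [← integral_prod (fun p : ℝ × ℝ =>
    Real.fourierChar (-(p.1 * σ)) • (extDisk f (linePt p.1 φ p.2) : ℂ)) hint,
    ← Measure.volume_eq_prod]
  -- The phase depends on a point only through its offset, so the iterated integral over `(s, t)` is
  -- the integral over the plane of `H` pulled back along a rotation.
  let H : ℝ × ℝ → ℂ := fun x => Real.fourierChar (-(dotDir x φ * σ)) • (extDisk f x : ℂ)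
  have hH : AEStronglyMeasurable H volume := by
    refine AEStronglyMeasurable.fun_smul (Continuous.aestronglyMeasurable ?_)
      ((integrable_extDisk f).ofReal (𝕜 := ℂ)).1
    exact Real.continuous_fourierChar.comp (by unfold dotDir; fun_prop)
  have e1 : ∫ p : ℝ × ℝ, Real.fourierChar (-(p.1 * σ)) • (extDisk f (linePt p.1 φ p.2) : ℂ) =
      ∫ x, H x := by
    have hmap := integral_map (measurePreserving_linePt φ).measurable.aemeasurable
      (f := H) (by rwa [(measurePreserving_linePt φ).map_eq])
    rw [(measurePreserving_linePt φ).map_eq] at hmap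
    rw [hmap]
    refine integral_congr_ae (.of_forall fun p => ?_)
    have : dotDir (linePt p.1 φ p.2) φ = p.1 := by
      simp only [dotDir, linePt]
      linear_combination p.1 * Real.sin_sq_add_cos_sq φ
    simp only [H, this]
  rw [e1, ← Complex.volume_preserving_equiv_real_prod.integral_comp
    Complex.measurableEquivRealProd.measurableEmbedding]
  refine integral_congr_ae (.of_forall fun z => ?_)
  simp only [H, complexExt, Complex.measurableEquivRealProd_apply]
  congr 3
  simp [Complex.inner, dotDir, Complex.cos_ofReal_re, Complex.sin_ofReal_re]
  ring

/-! ### Shift energy and the offset modulus of continuity -/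

lemma lintegral_plane {F : ℝ × ℝ → ℝ≥0∞} (hF : Measurable F) :
    ∫⁻ z, F z = ∫⁻ φ, ∫⁻ s, F (s, φ) := by
  rw [Measure.volume_eq_prod, lintegral_prod_symm' _ hF]

/-- The squared `L²` distance between a function of `(s, φ)` and its translate in the offset. -/
def shiftEnergy (v : ℝ × ℝ → ℝ) (h : ℝ) : ℝ≥0∞ :=
  ∫⁻ z : ℝ × ℝ, ‖v (z.1 + h, z.2) - v z‖ₑ ^ 2

lemma measurePreserving_shift (h : ℝ) :
    MeasurePreserving (fun z : ℝ × ℝ => (z.1 + h, z.2)) volume volume :=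
  (measurePreserving_add_right volume h).prod (MeasurePreserving.id volume)

lemma shiftEnergy_congr {v w : ℝ × ℝ → ℝ} (hvw : v =ᵐ[volume] w) (h : ℝ) :
    shiftEnergy v h = shiftEnergy w h := by
  refine lintegral_congr_ae ?_
  filter_upwards [hvw, (measurePreserving_shift h).quasiMeasurePreserving.ae hvw] with z h1 h2
  rw [h1, h2]

lemma lintegral_enorm_sq_Lp {α : Type*} [MeasurableSpace α] {μ : Measure α} (g : Lp ℝ 2 μ) :
    ∫⁻ x, ‖g x‖ₑ ^ 2 ∂μ = ‖g‖ₑ ^ 2 := by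
  rw [Lp.enorm_def, eLpNorm_eq_lintegral_rpow_enorm_toReal (by norm_num) (by norm_num),
    ← ENNReal.rpow_natCast, ← ENNReal.rpow_mul]
  simp

section Sino

variable {A : AngularSet}

lemma measurable_extSino (g : L2Sino A) : Measurable (extSino g) :=
  (Lp.stronglyMeasurable g).measurable.indicator A.measurableSet_sino

lemma lintegral_extSino_sq (g : L2Sino A) : ∫⁻ z, ‖extSino g z‖ₑ ^ 2 = ‖g‖ₑ ^ 2 := by
  rw [← lintegral_enorm_sq_Lp g, ← lintegral_indicator A.measurableSet_sino]
  refine lintegral_congr fun z => ?_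
  by_cases hz : z ∈ A.sino <;> simp [extSino, hz]

lemma memLp_extSino (g : L2Sino A) : MemLp (extSino g) 2 := by
  refine ⟨(measurable_extSino g).aestronglyMeasurable, ?_⟩
  rw [eLpNorm_lt_top_iff_lintegral_rpow_enorm_lt_top (by norm_num) (by norm_num)]
  have := lintegral_extSino_sq g
  simp only [ENNReal.toReal_ofNat, ENNReal.rpow_ofNat, this]
  finiteness

lemma extSino_eq_zero_of_angle (g : L2Sino A) {s φ : ℝ} (hφ : φ ∉ Ico (-Real.pi) Real.pi) :
    extSino g (s, φ) = 0 :=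
  indicator_of_notMem (fun h => hφ (A.angles_subset h.2)) _

/-- Square integrability of the shifted difference justifies the interchange of the iterated Bochner
integrals in `modulus`. From here on estimates run on `shiftEnergy`, which needs no integrability.
-/
lemma ofReal_modulus_sq (g : L2Sino A) (h : ℝ) :
    ENNReal.ofReal (modulus g h ^ 2) = shiftEnergy (extSino g) h := by
  have hm : MemLp (fun z : ℝ × ℝ => extSino g (z.1 + h, z.2) - extSino g z) 2 :=
    ((memLp_extSino g).comp_measurePreserving (measurePreserving_shift h)).sub (memLp_extSino g)
  have hi := hm.integrable_sq
  have hswap : ∫ φ in Ico (-Real.pi) Real.pi,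
      ∫ s : ℝ, (extSino g (s + h, φ) - extSino g (s, φ)) ^ 2 =
      ∫ z : ℝ × ℝ, (extSino g (z.1 + h, z.2) - extSino g z) ^ 2 := by
    rw [setIntegral_eq_integral_of_forall_compl_eq_zero, Measure.volume_eq_prod,
      integral_prod_symm _ hi]
    intro φ hφ
    simp [extSino_eq_zero_of_angle g hφ]
  have hnn : 0 ≤ ∫ z : ℝ × ℝ, (extSino g (z.1 + h, z.2) - extSino g z) ^ 2 :=
    integral_nonneg fun z => sq_nonneg _
  rw [modulus, hswap, Real.sq_sqrt hnn, ofReal_integral_eq_lintegral_ofReal hi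
    (.of_forall fun z => sq_nonneg _), shiftEnergy]
  refine lintegral_congr fun z => ?_
  rw [Real.enorm_eq_ofReal_abs, ← ENNReal.ofReal_pow (abs_nonneg _), sq_abs]

end Sino

/-! ### The half-derivative estimate -/

open FourierTransform in
lemma fourier_shift_sub {v : ℝ → ℂ} (hv : Integrable v) (h σ : ℝ) :
    𝓕 (fun s => v (s + h) - v s) σ = ((Real.fourierChar (h * σ) : ℂ) - 1) * 𝓕 v σ := by
  have h1 := congrFun (VectorFourier.fourierIntegral_comp_add_right Real.fourierChar volume
    (innerₗ ℝ) v h) σ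
  have h2 : 𝓕 (fun s => v (s + h)) σ = (Real.fourierChar (h * σ) : ℂ) * 𝓕 v σ := by
    have : (innerₗ ℝ) h σ = h * σ := by simp [mul_comm]
    rw [this] at h1
    exact h1
  rw [sub_mul, one_mul, ← h2]
  simp only [Real.fourier_eq, smul_sub]
  exact integral_sub ((Real.fourierIntegral_convergent_iff σ).2 (hv.comp_add_right h))
    ((Real.fourierIntegral_convergent_iff σ).2 hv)

/-- The product of the two elementary bounds `2π|x|` and `2`. Keeping only the first power of `|x|`
is what later matches the Jacobian of polar coordinates. -/
lemma norm_fourierChar_sub_one_sq_le (x : ℝ) :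
    ‖(Real.fourierChar x : ℂ) - 1‖ ^ 2 ≤ 4 * Real.pi * |x| := by
  have h1 : ‖(Real.fourierChar x : ℂ) - 1‖ ≤ 2 * Real.pi * |x| := by
    have := Real.norm_exp_I_mul_ofReal_sub_one_le (x := 2 * Real.pi * x)
    rw [Real.fourierChar_apply, mul_comm _ Complex.I]
    refine this.trans (le_of_eq ?_)
    rw [Real.norm_eq_abs, abs_mul, abs_of_pos Real.two_pi_pos]
  have h2 : ‖(Real.fourierChar x : ℂ) - 1‖ ≤ 2 := by
    refine (norm_sub_le _ _).trans ?_
    rw [Circle.norm_coe, norm_one]; norm_num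
  nlinarith [norm_nonneg ((Real.fourierChar x : ℂ) - 1)]

-- Plancherel in the offset variable together with the slice theorem; the multiplier bound supplies
-- the weight `|σ|`.
open FourierTransform in
lemma lintegral_lineIntegral_shift_le (f : L2Disk) (φ h : ℝ) :
    ∫⁻ s, ‖lineIntegral (extDisk f) (s + h, φ) - lineIntegral (extDisk f) (s, φ)‖ₑ ^ 2 ≤
      ENNReal.ofReal (4 * Real.pi * |h|) * ∫⁻ σ : ℝ, ENNReal.ofReal |σ| *
        ‖𝓕 (complexExt f) (σ * (Real.cos φ + Real.sin φ * Complex.I))‖ₑ ^ 2 := by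
  set u : ℝ → ℂ := fun s => (lineIntegral (extDisk f) (s, φ) : ℂ) with hu
  have hu1 : Integrable u := (integrable_lineIntegral f φ).ofReal
  have hu2 : MemLp u 2 := (memLp_lineIntegral_offset f φ).ofReal
  have hP := lintegral_enorm_fourier_sq (f := fun s => u (s + h) - u s)
    ((hu1.comp_add_right h).sub hu1)
    ((hu2.comp_measurePreserving (measurePreserving_add_right volume h)).sub hu2)
  calc ∫⁻ s, ‖lineIntegral (extDisk f) (s + h, φ) - lineIntegral (extDisk f) (s, φ)‖ₑ ^ 2
      = ∫⁻ s, ‖u (s + h) - u s‖ₑ ^ 2 := by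
        refine lintegral_congr fun s => ?_
        rw [hu, ← Complex.ofReal_sub, ← ofReal_norm, ← ofReal_norm, Complex.norm_real]
    _ = ∫⁻ σ, ‖𝓕 (fun s => u (s + h) - u s) σ‖ₑ ^ 2 := hP.symm
    _ ≤ ∫⁻ σ, ENNReal.ofReal (4 * Real.pi * |h|) * (ENNReal.ofReal |σ| *
        ‖𝓕 (complexExt f) (σ * (Real.cos φ + Real.sin φ * Complex.I))‖ₑ ^ 2) := by
        refine lintegral_mono fun σ => ?_
        rw [fourier_shift_sub hu1, enorm_mul, mul_pow, hu, fourier_lineIntegral, ← mul_assoc,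
          ← ENNReal.ofReal_mul (by positivity)]
        refine mul_le_mul_left ?_ _
        rw [← ofReal_norm, ← ENNReal.ofReal_pow (norm_nonneg _)]
        refine ENNReal.ofReal_le_ofReal ((norm_fourierChar_sub_one_sq_le _).trans (le_of_eq ?_))
        rw [abs_mul]; ring
    _ = _ := lintegral_const_mul' _ _ ENNReal.ofReal_ne_top

/-- Integration over all lines through the origin, in polar coordinates. -/
lemma lintegral_polar_line {G : ℂ → ℝ≥0∞} (hG : Measurable G) :
    ∫⁻ φ in Ico (-Real.pi) Real.pi, ∫⁻ σ : ℝ, ENNReal.ofReal |σ| *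
      G (σ * (Real.cos φ + Real.sin φ * Complex.I)) = 2 * ∫⁻ z, G z := by
  have hpolar : ∀ {G : ℂ → ℝ≥0∞}, Measurable G →
      ∫⁻ φ in Ico (-Real.pi) Real.pi, ∫⁻ σ in Ioi (0 : ℝ), ENNReal.ofReal |σ| *
        G (σ * (Real.cos φ + Real.sin φ * Complex.I)) = ∫⁻ z, G z := by
    intro G hG
    rw [← Complex.lintegral_comp_polarCoord_symm, polarCoord_target, Measure.volume_eq_prod,
      ← Measure.prod_restrict, lintegral_prod_symm,
      ← restrict_Ioo_eq_restrict_Ico]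
    · refine lintegral_congr fun φ => setLIntegral_congr_fun measurableSet_Ioi fun σ hσ => ?_
      simp only [Complex.polarCoord_symm_apply, smul_eq_mul]
      rw [abs_of_pos hσ]
    · refine Measurable.aemeasurable ?_
      simp only [Complex.polarCoord_symm_apply, smul_eq_mul]
      fun_prop
  -- A full line is two opposite rays. As the angle runs over the circle each family of rays sweeps
  -- the plane once, which gives the factor 2.
  have hsplit : ∀ φ : ℝ, ∫⁻ σ : ℝ, ENNReal.ofReal |σ| *
      G (σ * (Real.cos φ + Real.sin φ * Complex.I)) =
      (∫⁻ σ in Ioi (0 : ℝ), ENNReal.ofReal |σ| *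
        G (σ * (Real.cos φ + Real.sin φ * Complex.I))) +
      ∫⁻ σ in Ioi (0 : ℝ), ENNReal.ofReal |σ| *
        G (-(σ * (Real.cos φ + Real.sin φ * Complex.I))) := by
    intro φ
    rw [← lintegral_add_compl _ (measurableSet_Ioi (a := (0 : ℝ))), compl_Ioi]
    congr 1
    rw [← Measure.restrict_congr_set Iio_ae_eq_Iic]
    have := (Measure.measurePreserving_neg (volume : Measure ℝ)).setLIntegral_comp_preimage_emb
      (MeasurableEquiv.neg ℝ).measurableEmbedding (fun σ : ℝ => ENNReal.ofReal |σ| *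
        G (σ * (Real.cos φ + Real.sin φ * Complex.I))) (Iio 0)
    rw [← this]
    simp
  simp_rw [hsplit]
  rw [lintegral_add_left, hpolar hG, hpolar (G := fun z => G (-z)) (by fun_prop), two_mul]
  · congr 1
    exact (Measure.measurePreserving_neg (volume : Measure ℂ)).lintegral_comp hG
  · refine Measurable.lintegral_prod_right' (f := fun p : ℝ × ℝ => ENNReal.ofReal |p.2| *
      G (p.2 * (Real.cos p.1 + Real.sin p.1 * Complex.I))) ?_
    fun_prop

open FourierTransform in
/-- The Radon transform gains half a derivative in the offset variable. -/
lemma lintegral_lineIntegral_shift_le_norm (f : L2Disk) (h : ℝ) :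
    ∫⁻ φ in Ico (-Real.pi) Real.pi, ∫⁻ s,
      ‖lineIntegral (extDisk f) (s + h, φ) - lineIntegral (extDisk f) (s, φ)‖ₑ ^ 2 ≤
      ENNReal.ofReal (8 * Real.pi * |h|) * ‖f‖ₑ ^ 2 := by
  have hcont : Continuous (𝓕 (complexExt f)) :=
    VectorFourier.fourierIntegral_continuous Real.continuous_fourierChar
      (by exact continuous_inner) (integrable_complexExt f)
  refine (lintegral_mono fun φ => lintegral_lineIntegral_shift_le f φ h).trans ?_
  rw [lintegral_const_mul' _ _ ENNReal.ofReal_ne_top,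
    lintegral_polar_line (hcont.measurable.enorm.pow_const 2),
    lintegral_enorm_fourier_sq (integrable_complexExt f) (memLp_complexExt f),
    lintegral_complexExt_sq, ← mul_assoc]
  refine le_of_eq ?_
  congr 1
  rw [mul_comm, ← ENNReal.ofReal_ofNat, ← ENNReal.ofReal_mul (by norm_num)]
  congr 1; ring

lemma lineIntegral_extDisk_eq_zero (f : L2Disk) {s : ℝ} (hs : s ∉ Ioo (-1 : ℝ) 1) (φ : ℝ) :
    lineIntegral (extDisk f) (s, φ) = 0 := by
  refine integral_eq_zero_of_ae (.of_forall fun t => indicator_of_notMem (fun h => hs ?_) _)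
  have h1 : (s * Real.cos φ - t * Real.sin φ) ^ 2 + (s * Real.sin φ + t * Real.cos φ) ^ 2 < 1 := h
  have h2 : (s * Real.cos φ - t * Real.sin φ) ^ 2 + (s * Real.sin φ + t * Real.cos φ) ^ 2
      = s ^ 2 + t ^ 2 := by
    linear_combination (s ^ 2 + t ^ 2) * Real.sin_sq_add_cos_sq φ
  constructor <;> nlinarith [sq_nonneg t]

lemma extSino_radon_ae (A : AngularSet) (f : L2Disk) :
    extSino (radon A f) =ᵐ[volume] A.sino.indicator (lineIntegral (extDisk f)) := by
  filter_upwards [(ae_restrict_iff' A.measurableSet_sino).1 (radon_coeFn A f)] with z hz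
  by_cases h : z ∈ A.sino
  · simpa [extSino, h] using hz h
  · simp [extSino, h]

/-- Lines with `|s| ≥ 1` miss the disk, so cutting off at the detector interval changes nothing. The
restriction is purely angular and hence commutes with shifts in the offset. -/
lemma sino_indicator_lineIntegral (A : AngularSet) (f : L2Disk) (s φ : ℝ) :
    A.sino.indicator (lineIntegral (extDisk f)) (s, φ) =
      A.angles.indicator (fun φ => lineIntegral (extDisk f) (s, φ)) φ := by
  by_cases hφ : φ ∈ A.angles
  · by_cases hs : s ∈ Ioo (-1 : ℝ) 1
    · have : (s, φ) ∈ A.sino := ⟨hs, hφ⟩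
      simp [this, hφ]
    · have : (s, φ) ∉ A.sino := fun h => hs h.1
      simp [this, hφ, lineIntegral_extDisk_eq_zero f hs]
  · have : (s, φ) ∉ A.sino := fun h => hφ h.2
    simp [this, hφ]

/-- Restricting the angles only discards nonnegative contributions to the full-circle estimate. -/
lemma shiftEnergy_extSino_radon_le (A : AngularSet) (f : L2Disk) (h : ℝ) :
    shiftEnergy (extSino (radon A f)) h ≤ ENNReal.ofReal (8 * Real.pi * |h|) * ‖f‖ₑ ^ 2 := by
  have hu : Measurable (lineIntegral (extDisk f)) := (stronglyMeasurable_lineIntegral f).measurable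
  have hv : Measurable (A.sino.indicator (lineIntegral (extDisk f))) :=
    hu.indicator A.measurableSet_sino
  rw [shiftEnergy_congr (extSino_radon_ae A f), shiftEnergy,
    lintegral_plane (by fun_prop)]
  refine le_trans ?_ (lintegral_lineIntegral_shift_le_norm f h)
  rw [← lintegral_indicator measurableSet_Ico]
  refine lintegral_mono fun φ => ?_
  simp only [sino_indicator_lineIntegral]
  by_cases hφ : φ ∈ A.angles
  · simp [hφ, A.angles_subset hφ]
  · simp [hφ]

/-- The offset modulus of continuity of a Radon transform is of order `1/2`. -/
lemma modulus_radon_le (A : AngularSet) (f : L2Disk) (h : ℝ) :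
    modulus (radon A f) h ≤ √(8 * Real.pi * |h|) * ‖f‖ := by
  have h0 : 0 ≤ 8 * Real.pi * |h| := by positivity
  refine (pow_le_pow_iff_left₀ (Real.sqrt_nonneg _) (by positivity) two_ne_zero).1 ?_
  rw [mul_pow, Real.sq_sqrt h0, ← ENNReal.ofReal_le_ofReal_iff (by positivity)]
  change ENNReal.ofReal (modulus (radon A f) h ^ 2) ≤ _
  rw [ofReal_modulus_sq, ENNReal.ofReal_mul h0, ENNReal.ofReal_pow (norm_nonneg _), ofReal_norm]
  exact shiftEnergy_extSino_radon_le A f h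

/-! ### Averaging with doubly stochastic kernels -/

lemma lintegral_mul_sq_le {α : Type*} [MeasurableSpace α] {μ : Measure α} {f g : α → ℝ≥0∞}
    (hf : AEMeasurable f μ) (hg : AEMeasurable g μ) :
    (∫⁻ x, f x * g x ∂μ) ^ 2 ≤ (∫⁻ x, f x ^ 2 ∂μ) * ∫⁻ x, g x ^ 2 ∂μ := by
  have h := ENNReal.lintegral_mul_le_Lp_mul_Lq μ (p := 2) (q := 2)
    (by constructor <;> norm_num) hf hg
  have h2 := pow_le_pow_left' h 2
  simp only [Pi.mul_apply, ENNReal.rpow_ofNat] at h2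
  refine h2.trans (le_of_eq ?_)
  rw [mul_pow, ← ENNReal.rpow_mul_natCast, ← ENNReal.rpow_mul_natCast]
  norm_num

/-- Cauchy–Schwarz on a window of length `2r`, then Tonelli: one factor `2r` comes from each. -/
lemma lintegral_window_sq_le {Φ : ℝ → ℝ × ℝ → ℝ≥0∞} (hΦ : Measurable (Function.uncurry Φ))
    {r : ℝ} {m : ℝ≥0∞} (hm : ∀ h ∈ Icc (-r) r, ∫⁻ z, Φ h z ^ 2 ≤ m) :
    ∫⁻ z, (∫⁻ h in Icc (-r) r, Φ h z) ^ 2 ≤ ENNReal.ofReal (2 * r) ^ 2 * m := by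
  have hvol : (volume : Measure ℝ) (Icc (-r) r) = ENNReal.ofReal (2 * r) := by
    rw [Real.volume_Icc]; congr 1; ring
  have hΦz : ∀ z, Measurable fun h => Φ h z := fun z => hΦ.of_uncurry_right
  have hΦ' : Measurable fun p : (ℝ × ℝ) × ℝ => Φ p.2 p.1 ^ 2 :=
    (hΦ.comp measurable_swap).pow_const 2
  have hCS : ∀ z, (∫⁻ h in Icc (-r) r, Φ h z) ^ 2 ≤
      ENNReal.ofReal (2 * r) * ∫⁻ h in Icc (-r) r, Φ h z ^ 2 := by
    intro z
    have := lintegral_mul_sq_le (μ := volume.restrict (Icc (-r) r)) (f := fun _ => 1)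
      (g := fun h => Φ h z) aemeasurable_const (hΦz z).aemeasurable
    simpa [hvol] using this
  calc ∫⁻ z, (∫⁻ h in Icc (-r) r, Φ h z) ^ 2
      ≤ ∫⁻ z, ENNReal.ofReal (2 * r) * ∫⁻ h in Icc (-r) r, Φ h z ^ 2 := lintegral_mono hCS
    _ = ENNReal.ofReal (2 * r) * ∫⁻ h in Icc (-r) r, ∫⁻ z, Φ h z ^ 2 := by
        rw [lintegral_const_mul' _ _ ENNReal.ofReal_ne_top,
          lintegral_lintegral_swap hΦ'.aemeasurable]
    _ ≤ ENNReal.ofReal (2 * r) * ∫⁻ _h in Icc (-r) r, m := by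
        refine mul_le_mul_right (setLIntegral_mono measurable_const hm) _
    _ = ENNReal.ofReal (2 * r) ^ 2 * m := by
        rw [setLIntegral_const, hvol]; ring

lemma setLIntegral_Icc_shift (F : ℝ → ℝ≥0∞) (s r : ℝ) :
    ∫⁻ t in Icc (s - r) (s + r), F t = ∫⁻ h in Icc (-r) r, F (s + h) := by
  rw [← (measurePreserving_add_left volume s).setLIntegral_comp_preimage_emb
    (measurableEmbedding_addLeft s)]
  congr 2
  ext h
  simp only [mem_preimage, mem_Icc]
  constructor <;> rintro ⟨h1, h2⟩ <;> constructor <;> linarith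

/-- A doubly stochastic kernel on the line, of height at most `1 / δ` and supported within distance
`2 δ` of the diagonal. -/
structure AveragingKernel (δ : ℝ) (κ : ℝ → ℝ → ℝ) : Prop where
  measurable : Measurable (Function.uncurry κ)
  nonneg : ∀ s t, 0 ≤ κ s t
  le : ∀ s t, κ s t ≤ 1 / δ
  eq_zero : ∀ s t, 2 * δ < |t - s| → κ s t = 0
  integral_right : ∀ s, ∫ t, κ s t = 1
  integral_left : ∀ t, ∫ s, κ s t = 1

/-- The deviation of the `κ`-average in the offset variable from the function itself. -/
def averageDefect (κ : ℝ → ℝ → ℝ) (v : ℝ × ℝ → ℝ) (z : ℝ × ℝ) : ℝ :=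
  ∫ t, κ z.1 t * (v (t, z.2) - v z)

lemma lintegral_mul_sq_le_L2 {α : Type*} [MeasurableSpace α] {μ : Measure α} {f g : α → ℝ}
    (hf : AEStronglyMeasurable f μ) (hg : AEStronglyMeasurable g μ) {a b : ℝ}
    (ha : 0 ≤ a) (hb : 0 ≤ b) (hfa : ∫⁻ x, ‖f x‖ₑ ^ 2 ∂μ ≤ ENNReal.ofReal (a ^ 2))
    (hgb : ∫⁻ x, ‖g x‖ₑ ^ 2 ∂μ ≤ ENNReal.ofReal (b ^ 2)) :
    |∫ x, f x * g x ∂μ| ≤ a * b := by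
  have h1 : ‖∫ x, f x * g x ∂μ‖ₑ ≤ ∫⁻ x, ‖f x‖ₑ * ‖g x‖ₑ ∂μ := by
    refine (enorm_integral_le_lintegral_enorm _).trans (le_of_eq ?_)
    simp_rw [enorm_mul]
  have h2 : ‖∫ x, f x * g x ∂μ‖ₑ ^ 2 ≤ ENNReal.ofReal ((a * b) ^ 2) := by
    refine (pow_le_pow_left' h1 2).trans ((lintegral_mul_sq_le hf.enorm hg.enorm).trans ?_)
    rw [mul_pow, ENNReal.ofReal_mul (sq_nonneg a)]
    exact mul_le_mul' hfa hgb
  rw [Real.enorm_eq_ofReal_abs, ← ENNReal.ofReal_pow (abs_nonneg _),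
    ENNReal.ofReal_le_ofReal_iff (sq_nonneg _)] at h2
  exact (pow_le_pow_iff_left₀ (abs_nonneg _) (by positivity) two_ne_zero).1 h2

namespace AveragingKernel

variable {δ : ℝ} {κ : ℝ → ℝ → ℝ}

/-- The conditions are symmetric in the two arguments. The transposed kernel is the one that acts on
the data when the adjoint is estimated. -/
lemma swap (hκ : AveragingKernel δ κ) : AveragingKernel δ fun s t => κ t s where
  measurable := hκ.measurable.comp measurable_swap
  nonneg s t := hκ.nonneg t s
  le s t := hκ.le t s
  eq_zero s t h := hκ.eq_zero t s (by rwa [abs_sub_comm])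
  integral_right := hκ.integral_left
  integral_left := hκ.integral_right

lemma stronglyMeasurable_averageDefect (hκ : AveragingKernel δ κ) {v : ℝ × ℝ → ℝ}
    (hv : Measurable v) : StronglyMeasurable (averageDefect κ v) := by
  have hm := hκ.measurable
  refine StronglyMeasurable.integral_prod_right
    (f := fun z : ℝ × ℝ => fun t => κ z.1 t * (v (t, z.2) - v z)) (Measurable.stronglyMeasurable ?_)
  have h1 : Measurable fun p : (ℝ × ℝ) × ℝ => Function.uncurry κ (p.1.1, p.2) :=
    hm.comp (by fun_prop)
  exact h1.mul (by fun_prop)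

/-- The height bound `1/δ` against a window of length `4δ` gives the factor `4² = 16`, independent
of `δ`. -/
lemma lintegral_averageDefect_le (hκ : AveragingKernel δ κ) (hδ : 0 < δ) {v : ℝ × ℝ → ℝ}
    (hv : Measurable v) {m : ℝ≥0∞} (hm : ∀ h, |h| ≤ 2 * δ → shiftEnergy v h ≤ m) :
    ∫⁻ z, ‖averageDefect κ v z‖ₑ ^ 2 ≤ 16 * m := by
  have hpt : ∀ z, ‖averageDefect κ v z‖ₑ ≤ ENNReal.ofReal (1 / δ) *
      ∫⁻ h in Icc (-(2 * δ)) (2 * δ), ‖v (z.1 + h, z.2) - v z‖ₑ := by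
    intro z
    rw [← setLIntegral_Icc_shift (fun t => ‖v (t, z.2) - v z‖ₑ),
      ← lintegral_const_mul' _ _ ENNReal.ofReal_ne_top, ← lintegral_indicator measurableSet_Icc]
    refine (enorm_integral_le_lintegral_enorm _).trans (lintegral_mono fun t => ?_)
    rw [enorm_mul]
    by_cases ht : t ∈ Icc (z.1 - 2 * δ) (z.1 + 2 * δ)
    · rw [indicator_of_mem ht]
      refine mul_le_mul_left ?_ _
      rw [Real.enorm_eq_ofReal (hκ.nonneg _ _)]
      exact ENNReal.ofReal_le_ofReal (hκ.le _ _)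
    · rw [hκ.eq_zero, enorm_zero, zero_mul]
      · exact zero_le
      · by_contra! hc
        rw [abs_le] at hc
        exact ht ⟨by linarith, by linarith⟩
  calc ∫⁻ z, ‖averageDefect κ v z‖ₑ ^ 2
      ≤ ∫⁻ z, ENNReal.ofReal (1 / δ) ^ 2 *
        (∫⁻ h in Icc (-(2 * δ)) (2 * δ), ‖v (z.1 + h, z.2) - v z‖ₑ) ^ 2 :=
        lintegral_mono fun z => by
          rw [← mul_pow]; exact pow_le_pow_left' (hpt z) 2
    _ ≤ ENNReal.ofReal (1 / δ) ^ 2 * (ENNReal.ofReal (2 * (2 * δ)) ^ 2 * m) := by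
        rw [lintegral_const_mul' _ _ (by finiteness)]
        refine mul_le_mul_right (lintegral_window_sq_le
          (Φ := fun h z => ‖v (z.1 + h, z.2) - v z‖ₑ) ?_ fun h hh => hm h (abs_le.2 hh)) _
        simp only [Function.uncurry_def]
        fun_prop
    _ = 16 * m := by
        rw [← mul_assoc, ← mul_pow, ← ENNReal.ofReal_mul (by positivity)]
        have : 1 / δ * (2 * (2 * δ)) = 4 := by field_simp; norm_num
        rw [this]; norm_num

lemma integrable_mul (hκ : AveragingKernel δ κ) (s : ℝ) {u : ℝ → ℝ} (hu : Integrable u) :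
    Integrable fun t => κ s t * u t := by
  refine hu.bdd_mul (c := 1 / δ) (hκ.measurable.of_uncurry_left.aestronglyMeasurable)
    (.of_forall fun t => ?_)
  rw [Real.norm_eq_abs, abs_of_nonneg (hκ.nonneg _ _)]
  exact hκ.le _ _

lemma integral_mul_sub (hκ : AveragingKernel δ κ) (s c : ℝ) {u : ℝ → ℝ} (hu : Integrable u) :
    ∫ t, κ s t * (u t - c) = (∫ t, κ s t * u t) - c := by
  simp_rw [mul_sub]
  rw [integral_sub (hκ.integrable_mul s hu)
    ((integrable_of_integral_eq_one (hκ.integral_right s)).mul_const c), integral_mul_const,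
    hκ.integral_right, one_mul]

/-- Fubini transposes the averaging part. The subtracted diagonal terms are both `∫ g u`, because
rows and columns of the kernel each have integral one. -/
lemma integral_swap (hκ : AveragingKernel δ κ) {u g : ℝ → ℝ} (hu : Integrable u)
    (hg : Integrable g) (hgu : Integrable fun s => g s * u s) :
    ∫ s, g s * ∫ t, κ s t * (u t - u s) = ∫ s, u s * ∫ t, κ t s * (g t - g s) := by
  have hK : Integrable (fun p : ℝ × ℝ => κ p.1 p.2 * (g p.1 * u p.2))
      ((volume : Measure ℝ).prod volume) := by
    refine (hg.mul_prod hu).bdd_mul (c := 1 / δ) hκ.measurable.aestronglyMeasurable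
      (.of_forall fun p => ?_)
    rw [Real.norm_eq_abs, abs_of_nonneg (hκ.nonneg _ _)]
    exact hκ.le _ _
  have hL : Integrable fun s => g s * ∫ t, κ s t * u t := by
    refine hK.integral_prod_left.congr (.of_forall fun s => ?_)
    simp only [← integral_const_mul]
    refine integral_congr_ae (.of_forall fun t => ?_)
    simp only; ring
  have hR : Integrable fun t => u t * ∫ s, κ s t * g s := by
    refine hK.integral_prod_right.congr (.of_forall fun s => ?_)
    simp only [← integral_const_mul]
    refine integral_congr_ae (.of_forall fun t => ?_)
    simp only; ring
  have e1 : ∀ s, g s * ∫ t, κ s t * (u t - u s) = (g s * ∫ t, κ s t * u t) - g s * u s := by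
    intro s; rw [hκ.integral_mul_sub s _ hu, mul_sub]
  have e2 : ∀ s, u s * ∫ t, κ t s * (g t - g s) = (u s * ∫ t, κ t s * g t) - g s * u s := by
    intro s; rw [hκ.swap.integral_mul_sub s _ hg, mul_sub, mul_comm (g s)]
  simp_rw [e1, e2]
  rw [integral_sub hL hgu, integral_sub hR hgu]
  congr 1
  calc ∫ s, g s * ∫ t, κ s t * u t = ∫ s, ∫ t, κ s t * (g s * u t) := by
        refine integral_congr_ae (.of_forall fun s => ?_)
        simp only [← integral_const_mul]
        refine integral_congr_ae (.of_forall fun t => ?_)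
        simp only; ring
    _ = ∫ t, ∫ s, κ s t * (g s * u t) := integral_integral_swap hK
    _ = ∫ t, u t * ∫ s, κ s t * g s := by
        refine integral_congr_ae (.of_forall fun s => ?_)
        simp only [← integral_const_mul]
        refine integral_congr_ae (.of_forall fun t => ?_)
        simp only; ring

/-- No regularity is needed for this: `(a - b)² ≤ 2a² + 2b²` bounds every shift energy by four times
the squared norm. -/
lemma memLp_averageDefect (hκ : AveragingKernel δ κ) (hδ : 0 < δ) {v : ℝ × ℝ → ℝ}
    (hv : Measurable v) (hv2 : MemLp v 2) : MemLp (averageDefect κ v) 2 := by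
  refine ⟨(hκ.stronglyMeasurable_averageDefect hv).aestronglyMeasurable, ?_⟩
  rw [eLpNorm_lt_top_iff_lintegral_rpow_enorm_lt_top (by norm_num) (by norm_num)]
  simp only [ENNReal.toReal_ofNat, ENNReal.rpow_ofNat]
  have hfin : ∫⁻ z, ‖v z‖ₑ ^ 2 < ∞ := by
    have := lintegral_rpow_enorm_lt_top_of_eLpNorm_lt_top (p := 2) (by norm_num) (by norm_num) hv2.2
    simpa using this
  refine (hκ.lintegral_averageDefect_le hδ hv (m := 4 * ∫⁻ z, ‖v z‖ₑ ^ 2) fun h _ => ?_).trans_lt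
    (by finiteness)
  calc shiftEnergy v h
      ≤ ∫⁻ z : ℝ × ℝ, (2 * ‖v (z.1 + h, z.2)‖ₑ ^ 2 + 2 * ‖v z‖ₑ ^ 2) := by
        refine lintegral_mono fun z => ?_
        rw [← ofReal_norm, ← ofReal_norm, ← ofReal_norm, ← ENNReal.ofReal_pow (norm_nonneg _),
          ← ENNReal.ofReal_pow (norm_nonneg _), ← ENNReal.ofReal_pow (norm_nonneg _),
          ← ENNReal.ofReal_ofNat 2, ← ENNReal.ofReal_mul (by norm_num),
          ← ENNReal.ofReal_mul (by norm_num), ← ENNReal.ofReal_add (by positivity) (by positivity)]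
        refine ENNReal.ofReal_le_ofReal ?_
        simp only [Real.norm_eq_abs, sq_abs]
        nlinarith [sq_nonneg (v (z.1 + h, z.2) + v z)]
    _ = 4 * ∫⁻ z, ‖v z‖ₑ ^ 2 := by
        rw [lintegral_add_right _ (by fun_prop), lintegral_const_mul' _ _ (by norm_num),
          lintegral_const_mul' _ _ (by norm_num),
          (measurePreserving_shift h).lintegral_comp (f := fun z => ‖v z‖ₑ ^ 2) (by fun_prop),
          ← add_mul]
        norm_num

lemma integral_mul_averageDefect (hκ : AveragingKernel δ κ) (hδ : 0 < δ) {g u : ℝ × ℝ → ℝ}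
    (hg : Measurable g) (hg1 : Integrable g) (hg2 : MemLp g 2)
    (hu : Measurable u) (hu1 : Integrable u) (hu2 : MemLp u 2) :
    ∫ z, g z * averageDefect κ u z = ∫ z, u z * averageDefect (fun s t => κ t s) g z := by
  have h1 : Integrable fun z => g z * averageDefect κ u z :=
    hg2.integrable_mul (hκ.memLp_averageDefect hδ hu hu2)
  have h2 : Integrable fun z => u z * averageDefect (fun s t => κ t s) g z :=
    hu2.integrable_mul (hκ.swap.memLp_averageDefect hδ hg hg2)
  have h3 : Integrable fun z => g z * u z := hg2.integrable_mul hu2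
  rw [Measure.volume_eq_prod] at h1 h2 h3 hg1 hu1 ⊢
  rw [integral_prod_symm _ h1, integral_prod_symm _ h2]
  refine integral_congr_ae ?_
  -- For almost every angle all the slices are integrable, and the one-dimensional transposition
  -- applies.
  filter_upwards [h3.prod_left_ae, hg1.prod_left_ae, hu1.prod_left_ae] with φ h3 hg1 hu1
  exact hκ.integral_swap hu1 hg1 h3

end AveragingKernel

/-! ### The detector grid and its averaging kernel -/

/-- The centre of the cell containing `s`, for the grid of `cell δ n` extended to all integers. -/
def cellCenter (δ : ℝ) (n : ℕ) (s : ℝ) : ℝ :=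
  δ * ((⌊s / δ + n / 2 + 1⌋ : ℝ) - ((n : ℝ) + 1) / 2)

/-- The left end point of cell `i` is `δ (i - n/2 - 1)`, so the index of a cell is read off by a
floor function. This makes the cells disjoint and extends the grid to the whole line. -/
lemma mem_cell_iff {δ : ℝ} (hδ : 0 < δ) {n i : ℕ} {s : ℝ} :
    s ∈ cell δ n i ↔ ⌊s / δ + n / 2 + 1⌋ = (i : ℤ) := by
  have hs : s = δ * (s / δ) := by field_simp
  rw [Int.floor_eq_iff, cell, mem_Ico, gridPt, Int.cast_natCast]
  constructor
  · rintro ⟨h1, h2⟩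
    constructor
    · have : δ * ((i : ℝ) - n / 2 - 1) ≤ δ * (s / δ) := by rw [← hs]; linarith
      linarith [le_of_mul_le_mul_left this hδ]
    · have : δ * (s / δ) < δ * ((i : ℝ) - n / 2) := by rw [← hs]; linarith
      linarith [lt_of_mul_lt_mul_left this hδ.le]
  · rintro ⟨h1, h2⟩
    constructor
    · have := mul_le_mul_of_nonneg_left h1 hδ.le
      rw [mul_add, mul_add, ← hs] at this; linarith
    · have := mul_lt_mul_of_pos_left h2 hδ
      rw [mul_add, mul_add, ← hs] at this; linarith

lemma cellCenter_eq {δ : ℝ} (hδ : 0 < δ) {n i : ℕ} {s : ℝ} (hs : s ∈ cell δ n i) :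
    cellCenter δ n s = gridPt δ n i := by
  rw [cellCenter, (mem_cell_iff hδ).1 hs, gridPt, Int.cast_natCast]

lemma cell_index_unique {δ : ℝ} (hδ : 0 < δ) {n i j : ℕ} {s : ℝ} (hi : s ∈ cell δ n i)
    (hj : s ∈ cell δ n j) : i = j := by
  rw [mem_cell_iff hδ] at hi hj
  exact_mod_cast hi.symm.trans hj

lemma abs_sub_gridPt_le {δ : ℝ} {n i : ℕ} {s : ℝ} (hs : s ∈ cell δ n i) :
    |s - gridPt δ n i| ≤ δ / 2 := by
  rw [abs_le]
  constructor <;> linarith [hs.1, hs.2]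

lemma measurable_cellCenter (δ : ℝ) (n : ℕ) : Measurable (cellCenter δ n) := by
  unfold cellCenter
  fun_prop

lemma abs_cellCenter_sub_le {δ : ℝ} (hδ : 0 < δ) (n : ℕ) (s : ℝ) :
    |cellCenter δ n s - s| ≤ δ / 2 := by
  have h1 := Int.floor_le (s / δ + n / 2 + 1)
  have h2 := Int.lt_floor_add_one (s / δ + n / 2 + 1)
  have hs : s = δ * (s / δ) := by field_simp
  have e : cellCenter δ n s - s =
      δ * ((⌊s / δ + n / 2 + 1⌋ : ℝ) - ((n : ℝ) + 1) / 2 - s / δ) := by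
    rw [cellCenter, mul_sub δ _ (s / δ), ← hs]
  rw [e, abs_mul, abs_of_pos hδ]
  have : |(⌊s / δ + n / 2 + 1⌋ : ℝ) - ((n : ℝ) + 1) / 2 - s / δ| ≤ 1 / 2 := by
    rw [abs_le]; constructor <;> linarith
  nlinarith

lemma hat_nonneg (δ t : ℝ) : 0 ≤ hat δ t := le_max_left _ _

lemma hat_le {δ : ℝ} (hδ : 0 ≤ δ) (t : ℝ) : hat δ t ≤ δ :=
  max_le hδ (by linarith [abs_nonneg t])

lemma hat_eq_zero {δ t : ℝ} (h : δ ≤ |t|) : hat δ t = 0 := max_eq_left (by linarith)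

lemma continuous_hat (δ : ℝ) : Continuous (hat δ) := by unfold hat; fun_prop

lemma abs_hat_sub_le (δ a b : ℝ) : |hat δ a - hat δ b| ≤ |a - b| := by
  have h1 := abs_max_sub_max_le_abs (δ - |a|) (δ - |b|) 0
  have h2 := abs_abs_sub_abs_le b a
  rw [hat, hat, max_comm 0, max_comm 0]
  refine h1.trans ?_
  rw [show δ - |a| - (δ - |b|) = |b| - |a| by ring, abs_sub_comm a b]
  exact h2

lemma integral_hat {δ : ℝ} (hδ : 0 < δ) : ∫ t, hat δ t = δ ^ 2 := by
  have h1 : ∫ t, hat δ t = 2 * ∫ t in Ioi (0 : ℝ), max 0 (δ - t) :=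
    integral_comp_abs (f := fun t => max 0 (δ - t))
  have h2 : ∫ t in Ioi (0 : ℝ), max 0 (δ - t) = ∫ t in Ioc 0 δ, max 0 (δ - t) := by
    refine (setIntegral_eq_of_subset_of_forall_sdiff_eq_zero measurableSet_Ioi Ioc_subset_Ioi_self
      fun t ht => ?_)
    refine max_eq_left ?_
    by_contra! h
    exact ht.2 ⟨ht.1, by linarith⟩
  have h3 : ∫ t in Ioc 0 δ, max 0 (δ - t) = ∫ t in Ioc 0 δ, (δ - t) :=
    setIntegral_congr_fun measurableSet_Ioc fun t ht => max_eq_right (by linarith [ht.2])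
  rw [h1, h2, h3, ← intervalIntegral.integral_of_le hδ.le, intervalIntegral.integral_sub
    (by simp) (by simp)]
  simp
  ring

/-- The translated hat functions of the extended grid form a partition of unity. -/
lemma integral_hat_cellCenter {δ : ℝ} (hδ : 0 < δ) (n : ℕ) (t : ℝ) :
    ∫ s, hat δ (t - cellCenter δ n s) = δ ^ 2 := by
  -- `τ` is the index coordinate of `t`: its distance to the centre with index `m` is `δ |τ - m|`.
  set τ : ℝ := t / δ + ((n : ℝ) + 1) / 2 with hτ
  have ht : t = δ * (t / δ) := by field_simp
  have hhat : ∀ s, hat δ (t - cellCenter δ n s) =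
      max 0 (δ - δ * |τ - ⌊s / δ + n / 2 + 1⌋|) := by
    intro s
    have : t - cellCenter δ n s = δ * (τ - ⌊s / δ + n / 2 + 1⌋) := by
      rw [cellCenter, hτ]; linear_combination ht
    rw [hat, this, abs_mul, abs_of_pos hδ]
  let I : ℤ → Set ℝ := fun m => Ico (δ * (m - n / 2 - 1)) (δ * (m - n / 2))
  have hI : ∀ m s, s ∈ I m ↔ ⌊s / δ + n / 2 + 1⌋ = m := by
    intro m s
    rw [Int.floor_eq_iff]
    simp only [I, mem_Ico]
    rw [← le_div_iff₀' hδ, ← div_lt_iff₀' hδ]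
    constructor <;> rintro ⟨h1, h2⟩ <;> constructor <;> linarith
  have hvol : ∀ m, volume.real (I m) = δ := by
    intro m
    rw [Real.volume_real_Ico_of_le (by nlinarith)]
    ring
  have h1 := Int.floor_le τ
  have h2 := Int.lt_floor_add_one τ
  -- Only the cells with indices `⌊τ⌋` and `⌊τ⌋ + 1` see a nonzero hat. Their weights `δ (1 - fract
  -- τ)` and `δ fract τ` add up to `δ`.
  have hsum : (fun s => hat δ (t - cellCenter δ n s)) = fun s =>
      (I ⌊τ⌋).indicator (fun _ => δ * (1 - Int.fract τ)) s +
        (I (⌊τ⌋ + 1)).indicator (fun _ => δ * Int.fract τ) s := by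
    funext s
    rw [hhat]
    simp only [Set.indicator, hI]
    set m := ⌊s / δ + n / 2 + 1⌋
    have hf : τ = ⌊τ⌋ + Int.fract τ := (Int.floor_add_fract τ).symm
    have hf0 := Int.fract_nonneg τ
    have hf1 := Int.fract_lt_one τ
    rcases lt_trichotomy m ⌊τ⌋ with hm | hm | hm
    · rw [if_neg (by omega), if_neg (by omega), max_eq_left, add_zero]
      have : (m : ℝ) + 1 ≤ ⌊τ⌋ := by exact_mod_cast hm
      rw [abs_of_nonneg (by linarith)]
      nlinarith
    · rw [if_pos hm, if_neg (by omega), hm, Int.self_sub_floor, abs_of_nonneg hf0, max_eq_right,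
        add_zero]
      · ring
      · nlinarith
    · rw [if_neg (by omega)]
      by_cases hm1 : m = ⌊τ⌋ + 1
      · rw [if_pos hm1, hm1]
        have : τ - ((⌊τ⌋ + 1 : ℤ) : ℝ) = -(1 - Int.fract τ) := by push_cast; linarith
        rw [this, abs_neg, abs_of_nonneg (by linarith), max_eq_right]
        · ring
        · nlinarith
      · rw [if_neg hm1, max_eq_left, add_zero]
        have : (⌊τ⌋ : ℝ) + 2 ≤ m := by
          have : ⌊τ⌋ + 2 ≤ m := by omega
          exact_mod_cast this
        rw [abs_of_nonpos (by linarith)]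
        nlinarith
  have hint : ∀ m c, Integrable ((I m).indicator fun _ => (c : ℝ)) := fun m c =>
    (integrable_indicator_iff measurableSet_Ico).2 (integrableOn_const (by simp) (by simp))
  rw [hsum, integral_add (hint _ _) (hint _ _), integral_indicator measurableSet_Ico,
    integral_indicator measurableSet_Ico, setIntegral_const, setIntegral_const, hvol, hvol]
  simp only [smul_eq_mul]
  ring

/-- The kernel `w_δ(t - s_p) / δ²`, where `s_p` is the centre of the cell containing `s`. -/
def gridKernel (δ : ℝ) (n : ℕ) (s t : ℝ) : ℝ := hat δ (t - cellCenter δ n s) / δ ^ 2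

/-- Integration in `t` gives one by the area of the hat, integration in `s` by the partition of
unity. The latter holds for every `t` because the detector grid is continued beyond its `P` cells.
The distance to the diagonal is at most `3δ/2`, within the allowed `2δ`. -/
lemma averagingKernel_gridKernel {δ : ℝ} (hδ : 0 < δ) (n : ℕ) :
    AveragingKernel δ (gridKernel δ n) where
  measurable := by
    have h := measurable_cellCenter δ n
    have h2 := (continuous_hat δ).measurable
    exact (h2.comp (by fun_prop : Measurable fun p : ℝ × ℝ => p.2 - cellCenter δ n p.1)).div_const _
  nonneg s t := div_nonneg (hat_nonneg _ _) (by positivity)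
  le s t := by
    rw [gridKernel, div_le_div_iff₀ (by positivity) hδ]
    nlinarith [hat_le hδ.le (t - cellCenter δ n s)]
  eq_zero s t h := by
    rw [gridKernel, hat_eq_zero, zero_div]
    have h1 := abs_cellCenter_sub_le hδ n s
    have h2 := abs_sub_le t (cellCenter δ n s) s
    linarith
  integral_right s := by
    simp only [gridKernel]
    rw [integral_div, integral_sub_right_eq_self (hat δ), integral_hat hδ]
    field_simp
  integral_left t := by
    simp only [gridKernel]
    rw [integral_div, integral_hat_cellCenter hδ]
    field_simp

/-! ### Locating an angle in the discretization -/

lemma abs_cos_sub_cos_le (x y : ℝ) : |Real.cos x - Real.cos y| ≤ |x - y| := by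
  rw [Real.cos_sub_cos, abs_mul, abs_mul, abs_neg, abs_two]
  have h1 := Real.abs_sin_le_one ((x + y) / 2)
  have h2 := Real.abs_sin_le_abs (x := (x - y) / 2)
  rw [abs_div, abs_two] at h2
  nlinarith [abs_nonneg (Real.sin ((x + y) / 2)), abs_nonneg (Real.sin ((x - y) / 2))]

lemma abs_sin_sub_sin_le (x y : ℝ) : |Real.sin x - Real.sin y| ≤ |x - y| := by
  have := abs_cos_sub_cos_le (x - Real.pi / 2) (y - Real.pi / 2)
  rwa [Real.cos_sub_pi_div_two, Real.cos_sub_pi_div_two, sub_sub_sub_cancel_right] at this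

lemma abs_dotDir_sub_le {x : ℝ × ℝ} (hx : x ∈ disk) (φ ψ : ℝ) :
    |dotDir x φ - dotDir x ψ| ≤ 2 * |φ - ψ| := by
  obtain ⟨⟨h1, h2⟩, h3, h4⟩ := disk_subset hx
  have e : dotDir x φ - dotDir x ψ =
      x.1 * (Real.cos φ - Real.cos ψ) + x.2 * (Real.sin φ - Real.sin ψ) := by
    simp only [dotDir]; ring
  rw [e]
  refine (abs_add_le _ _).trans ?_
  rw [abs_mul, abs_mul]
  have a1 : |x.1| ≤ 1 := abs_le.2 ⟨h1.le, h2.le⟩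
  have a2 : |x.2| ≤ 1 := abs_le.2 ⟨h3.le, h4.le⟩
  nlinarith [abs_cos_sub_cos_le φ ψ, abs_sin_sub_sin_le φ ψ, abs_nonneg (Real.cos φ - Real.cos ψ),
    abs_nonneg (Real.sin φ - Real.sin ψ)]

/-- Angular pixels include left end points, whereas disjointness is assumed for open intervals. If
an interior angle of one interval were a left end point of another, a small move to the right would
land in both open intervals. -/
lemma modTwoPi_Ioo_disjoint_Ico (A : AngularSet) {k k' : Fin A.I} (hk : k ≠ k') {φ : ℝ}
    (h : φ ∈ modTwoPi (Ioo (A.a k) (A.b k))) : φ ∉ modTwoPi (Ico (A.a k') (A.b k')) := by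
  rintro ⟨-, n, hn1, hn2⟩
  obtain ⟨⟨hφ1, hφ2⟩, m, hm1, hm2⟩ := h
  obtain ⟨τ, hτ0, hτ⟩ : ∃ τ > 0, τ < min (Real.pi - φ) (min
      (A.b k - (φ + 2 * Real.pi * m)) (A.b k' - (φ + 2 * Real.pi * n))) :=
    exists_between (lt_min (by linarith) (lt_min (by linarith) (by linarith)))
  obtain ⟨h1, h2, h3⟩ : τ < Real.pi - φ ∧ τ < A.b k - (φ + 2 * Real.pi * m) ∧
      τ < A.b k' - (φ + 2 * Real.pi * n) := by simpa using hτ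
  have hIco : φ + τ ∈ Ico (-Real.pi) Real.pi := ⟨by linarith, by linarith⟩
  have hm' : φ + τ ∈ modTwoPi (Ioo (A.a k) (A.b k)) := ⟨hIco, m, by linarith, by linarith⟩
  have hn' : φ + τ ∈ modTwoPi (Ioo (A.a k') (A.b k')) := ⟨hIco, n, by linarith, by linarith⟩
  exact Set.disjoint_left.1 (A.disj hk) hm' hn'

namespace Discretization

variable {A : AngularSet} (D : Discretization A)

lemma φ_le_succ (k : Fin A.I) {q : ℕ} (hq : q ≤ D.Q k) : D.φ k q ≤ D.φ k (q + 1) := by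
  rcases Nat.eq_zero_or_pos q with rfl | h0
  · rw [D.φ_zero]
  · rcases hq.eq_or_lt with rfl | h1
    · rw [D.φ_succ]
    · exact (D.φ_mono k ⟨h0, hq⟩ ⟨by omega, h1⟩ (Nat.lt_succ_self q)).le

/-- The index `0` lies outside the supremum defining `δφ`. There the gap vanishes by `φ_zero` and it
suffices that `δφ` dominates some nonnegative gap. -/
lemma φ_succ_sub_le (k : Fin A.I) {q : ℕ} (hq : q ≤ D.Q k) : D.φ k (q + 1) - D.φ k q ≤ D.δφ := by
  have hsup : ∀ q : Fin (D.Q k), D.φ k (q + 2) - D.φ k (q + 1) ≤ D.δφ := fun q =>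
    (le_ciSup (f := fun q : Fin (D.Q k) => D.φ k (q + 2) - D.φ k (q + 1))
      (Set.finite_range _).bddAbove q).trans
      (le_ciSup (f := fun k : Fin A.I => ⨆ q : Fin (D.Q k), (D.φ k (q + 2) - D.φ k (q + 1)))
        (Set.finite_range _).bddAbove k)
  have hQ := D.Q_two k
  rcases q with _ | q
  · rw [zero_add, D.φ_zero, sub_self]
    refine le_trans ?_ (hsup ⟨0, by omega⟩)
    have := D.φ_le_succ k (q := 1) (by omega)
    simp only [zero_add]
    linarith
  · exact hsup ⟨q, hq⟩

lemma δφ_nonneg : 0 ≤ D.δφ := by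
  have := D.φ_succ_sub_le ⟨0, A.I_pos⟩ (q := 0) (Nat.zero_le _)
  rwa [zero_add, D.φ_zero, sub_self] at this

/-- The left end point of the `q`-th angular pixel. -/
def midAngle (k : Fin A.I) (q : ℕ) : ℝ := (D.φ k (q - 1) + D.φ k q) / 2

lemma midAngle_one (k : Fin A.I) : D.midAngle k 1 = A.a k := by
  rw [midAngle, Nat.sub_self, D.φ_zero, D.φ_first]; ring

lemma midAngle_last (k : Fin A.I) : D.midAngle k (D.Q k + 1) = A.b k := by
  rw [midAngle, Nat.add_sub_cancel, D.φ_succ, D.φ_last]; ring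

lemma midAngle_mono (k : Fin A.I) {p q : ℕ} (hp : 1 ≤ p) (hpq : p ≤ q) (hq : q ≤ D.Q k + 1) :
    D.midAngle k p ≤ D.midAngle k q := by
  induction q, hpq using Nat.le_induction with
  | base => exact le_rfl
  | succ q hpq ih =>
    refine (ih (by omega)).trans ?_
    have h1 := D.φ_le_succ k (q := q - 1) (by omega)
    have h2 := D.φ_le_succ k (q := q) (by omega)
    rw [Nat.sub_add_cancel (by omega)] at h1
    simp only [midAngle, Nat.add_sub_cancel]
    linarith

/-- The repeated first and last angles make the pixel boundaries start at `a` and end at `b`, so the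
pixels tile the interval. The pixel is found by descending to the first boundary exceeding `y`. -/
lemma exists_midAngle (k : Fin A.I) {y : ℝ} (hy : y ∈ Ico (A.a k) (A.b k)) :
    ∃ q ∈ Finset.Icc 1 (D.Q k), y ∈ Ico (D.midAngle k q) (D.midAngle k (q + 1)) := by
  have key : ∀ n, y < D.midAngle k (n + 1) →
      ∃ q ∈ Finset.Icc 1 n, y ∈ Ico (D.midAngle k q) (D.midAngle k (q + 1)) := by
    intro n
    induction n with
    | zero =>
      intro h
      rw [zero_add, D.midAngle_one] at h
      exact absurd hy.1 (not_le.2 h)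
    | succ n ih =>
      intro h
      by_cases hn : y < D.midAngle k (n + 1)
      · obtain ⟨q, hq, hyq⟩ := ih hn
        exact ⟨q, Finset.Icc_subset_Icc_right (Nat.le_succ n) hq, hyq⟩
      · exact ⟨n + 1, by simp, not_lt.1 hn, h⟩
  exact key _ (by rw [D.midAngle_last]; exact hy.2)

lemma midAngle_unique (k : Fin A.I) {y : ℝ} {p q : ℕ} (hp : p ∈ Finset.Icc 1 (D.Q k))
    (hq : q ∈ Finset.Icc 1 (D.Q k)) (hyp : y ∈ Ico (D.midAngle k p) (D.midAngle k (p + 1)))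
    (hyq : y ∈ Ico (D.midAngle k q) (D.midAngle k (q + 1))) : p = q := by
  rw [Finset.mem_Icc] at hp hq
  by_contra hne
  rcases lt_or_gt_of_ne hne with h | h
  · have := D.midAngle_mono k (p := p + 1) (q := q) (by omega) h (by omega)
    linarith [hyp.2, hyq.1]
  · have := D.midAngle_mono k (p := q + 1) (q := p) (by omega) h (by omega)
    linarith [hyq.2, hyp.1]

lemma Ico_midAngle_subset (k : Fin A.I) {q : ℕ} (hq : q ∈ Finset.Icc 1 (D.Q k)) :
    Ico (D.midAngle k q) (D.midAngle k (q + 1)) ⊆ Ico (A.a k) (A.b k) := by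
  rw [Finset.mem_Icc] at hq
  refine Ico_subset_Ico ?_ ?_
  · rw [← D.midAngle_one]; exact D.midAngle_mono k le_rfl hq.1 (by omega)
  · rw [← D.midAngle_last]; exact D.midAngle_mono k (by omega) (by omega) le_rfl

/-- Every angle of `𝒜` lies in exactly one angular pixel, and its direction is within `δ_φ` of the
direction of the pixel. -/
lemma exists_angPixel {φ : ℝ} (hφ : φ ∈ A.angles) :
    ∃ k, ∃ q ∈ Finset.Icc 1 (D.Q k), φ ∈ D.angPixel k q ∧
      (∀ k', ∀ q' ∈ Finset.Icc 1 (D.Q k'), φ ∈ D.angPixel k' q' → k' = k ∧ q' = q) ∧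
      ∀ x ∈ disk, |dotDir x (D.φ k q) - dotDir x φ| ≤ D.δφ := by
  obtain ⟨k, hk⟩ := mem_iUnion.1 hφ
  obtain ⟨hφ', m, hm⟩ := id hk
  obtain ⟨q, hq, hyq⟩ := D.exists_midAngle k (Ioo_subset_Ico_self hm)
  refine ⟨k, q, hq, ⟨hφ', m, hyq⟩, fun k' q' hq' h => ?_, fun x hx => ?_⟩
  · by_cases hkk : k' = k
    · subst hkk
      obtain ⟨-, n, hn⟩ := h
      have hn' := D.Ico_midAngle_subset k' hq' hn
      have hle := A.le k'
      have hpi := Real.two_pi_pos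
      -- Two representatives of `φ` in an interval of length at most `2π`, one of them in its
      -- interior, coincide.
      have hnm : n = m := by
        have h1 : 2 * Real.pi * ((n : ℝ) - m) < 2 * Real.pi * 1 := by
          linarith [hn'.2, hm.1]
        have h2 : 2 * Real.pi * ((m : ℝ) - n) < 2 * Real.pi * 1 := by
          linarith [hn'.1, hm.2]
        have h3 := lt_of_mul_lt_mul_left h1 hpi.le
        have h4 := lt_of_mul_lt_mul_left h2 hpi.le
        have h5 : n - m < 1 := by exact_mod_cast h3
        have h6 : m - n < 1 := by exact_mod_cast h4
        omega
      subst hnm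
      exact ⟨rfl, D.midAngle_unique k' hq' hq hn hyq⟩
    · obtain ⟨h1, n, hn⟩ := h
      exact absurd ⟨h1, n, D.Ico_midAngle_subset k' hq' hn⟩
        (modTwoPi_Ioo_disjoint_Ico A (Ne.symm hkk) hk)
  · have hper : dotDir x φ = dotDir x (φ + 2 * Real.pi * m) := by
      simp only [dotDir]
      rw [mul_comm (2 * Real.pi), Real.cos_add_int_mul_two_pi, Real.sin_add_int_mul_two_pi]
    rw [hper]
    -- Pixel boundaries are midpoints, so the angle is within `δφ / 2` of the node; the Lipschitz
    -- constant 2 turns this into `δφ`.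
    refine (abs_dotDir_sub_le hx _ _).trans ?_
    rw [Finset.mem_Icc] at hq
    have h1 := D.φ_succ_sub_le k (q := q - 1) (by omega)
    have h2 := D.φ_succ_sub_le k (q := q) hq.2
    rw [Nat.sub_add_cancel hq.1] at h1
    have h3 := hyq.1
    have h4 := hyq.2
    simp only [midAngle, Nat.add_sub_cancel] at h3 h4
    have : |D.φ k q - (φ + 2 * Real.pi * m)| ≤ D.δφ / 2 := by
      rw [abs_le]; constructor <;> linarith
    linarith

end Discretization

/-! ### Consistency of the discretization -/

lemma dotDir_linePt (s φ t : ℝ) : dotDir (linePt s φ t) φ = s := by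
  simp only [dotDir, linePt]
  linear_combination s * Real.sin_sq_add_cos_sq φ

/-- The `κ`-average of the Radon transform as an integral over the plane. -/
lemma integral_gridKernel_lineIntegral (f : L2Disk) {δ : ℝ} (hδ : 0 < δ) (n : ℕ) (s φ : ℝ) :
    ∫ t, gridKernel δ n s t * lineIntegral (extDisk f) (t, φ) =
      1 / δ ^ 2 * ∫ x, extDisk f x * hat δ (dotDir x φ - cellCenter δ n s) := by
  let H : ℝ × ℝ → ℝ := fun x => extDisk f x * hat δ (dotDir x φ - cellCenter δ n s)
  have hHm : Measurable H := by
    have h1 := measurable_extDisk f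
    have h2 := (continuous_hat δ).measurable
    have h3 : Measurable fun x : ℝ × ℝ => dotDir x φ := by unfold dotDir; fun_prop
    fun_prop
  have hHi : Integrable H := by
    refine (integrable_extDisk f).mul_bdd (c := δ) ?_ (.of_forall fun x => ?_)
    · have h2 := (continuous_hat δ).measurable
      have h3 : Measurable fun x : ℝ × ℝ => dotDir x φ := by unfold dotDir; fun_prop
      exact (h2.comp (h3.sub_const _)).aestronglyMeasurable
    · rw [Real.norm_eq_abs, abs_of_nonneg (hat_nonneg _ _)]
      exact hat_le hδ.le _
  have hmap := integral_map (μ := volume) (measurePreserving_linePt φ).measurable.aemeasurable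
    (f := H) hHm.aestronglyMeasurable
  rw [(measurePreserving_linePt φ).map_eq] at hmap
  have hi : Integrable fun p : ℝ × ℝ => H (linePt p.1 φ p.2) :=
    (measurePreserving_linePt φ).integrable_comp_of_integrable hHi
  change _ = 1 / δ ^ 2 * ∫ x, H x
  rw [hmap, Measure.volume_eq_prod, integral_prod _ hi, ← integral_const_mul]
  refine integral_congr_ae (.of_forall fun t => ?_)
  simp only [H, dotDir_linePt, gridKernel, lineIntegral]
  rw [integral_mul_const]
  ring

/-- The integrals of `‖f‖` over lines. -/
def lineMass (f : L2Disk) (z : ℝ × ℝ) : ℝ≥0∞ := ∫⁻ t : ℝ, ‖extDisk f (linePt z.1 z.2 t)‖ₑ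

lemma measurable_lineMass (f : L2Disk) : Measurable (lineMass f) :=
  ((measurable_extDisk f).enorm.comp measurable_linePt).lintegral_prod_right'

lemma lineMass_sq_le (f : L2Disk) (z : ℝ × ℝ) :
    lineMass f z ^ 2 ≤ 2 * ∫⁻ t : ℝ, ‖extDisk f (linePt z.1 z.2 t)‖ₑ ^ 2 := by
  have hm : Measurable fun t : ℝ => ‖extDisk f (linePt z.1 z.2 t)‖ₑ :=
    ((measurable_extDisk f).comp (by unfold linePt; fun_prop)).enorm
  have h1 : lineMass f z = ∫⁻ t in Icc (-1 : ℝ) 1, 1 * ‖extDisk f (linePt z.1 z.2 t)‖ₑ := by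
    simp only [one_mul]
    rw [lineMass, ← lintegral_indicator measurableSet_Icc]
    refine lintegral_congr fun t => ?_
    by_cases ht : t ∈ Icc (-1 : ℝ) 1
    · rw [indicator_of_mem ht]
    · rw [indicator_of_notMem ht, extDisk_linePt_eq_zero f ht, enorm_zero]
  rw [h1]
  refine (lintegral_mul_sq_le aemeasurable_const hm.aemeasurable).trans ?_
  rw [one_pow, setLIntegral_one, Real.volume_Icc]
  norm_num
  exact mul_le_mul_right (setLIntegral_le_lintegral _ _) _

lemma lintegral_lineMass_sq_le (f : L2Disk) (φ : ℝ) :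
    ∫⁻ s, lineMass f (s, φ) ^ 2 ≤ 2 * ‖f‖ₑ ^ 2 := by
  have hG : Measurable fun x => ‖extDisk f x‖ₑ ^ 2 := (measurable_extDisk f).enorm.pow_const _
  have hφ : Measurable fun p : ℝ × ℝ => ‖extDisk f (linePt p.1 φ p.2)‖ₑ ^ 2 :=
    hG.comp (by unfold linePt; fun_prop)
  refine (lintegral_mono fun s => lineMass_sq_le f (s, φ)).trans (le_of_eq ?_)
  rw [lintegral_const_mul _ hφ.lintegral_prod_right', ← lintegral_extDisk_sq,
    ← (measurePreserving_linePt φ).lintegral_comp hG, Measure.volume_eq_prod,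
    lintegral_prod _ hφ.aemeasurable]

/-- In coordinates rotated by `φ` the strip is a product of an offset window with a line. This
converts pointwise errors in the plane into offset windows of `lineMass`. -/
lemma setLIntegral_extDisk_strip (f : L2Disk) (φ a b : ℝ) :
    ∫⁻ x in {x | dotDir x φ ∈ Icc a b}, ‖extDisk f x‖ₑ =
      ∫⁻ s in Icc a b, lineMass f (s, φ) := by
  have hd : Measurable fun x : ℝ × ℝ => dotDir x φ := by unfold dotDir; fun_prop
  have hS : MeasurableSet {x | dotDir x φ ∈ Icc a b} := hd measurableSet_Icc
  have hG : Measurable ({x | dotDir x φ ∈ Icc a b}.indicator fun x => ‖extDisk f x‖ₑ) :=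
    (measurable_extDisk f).enorm.indicator hS
  have hφ : Measurable fun p : ℝ × ℝ =>
      {x | dotDir x φ ∈ Icc a b}.indicator (fun x => ‖extDisk f x‖ₑ) (linePt p.1 φ p.2) :=
    hG.comp (by unfold linePt; fun_prop)
  rw [← lintegral_indicator hS, ← (measurePreserving_linePt φ).lintegral_comp hG,
    Measure.volume_eq_prod, lintegral_prod _ hφ.aemeasurable, ← lintegral_indicator measurableSet_Icc]
  have hmem : ∀ s t, linePt s φ t ∈ {x | dotDir x φ ∈ Icc a b} ↔ s ∈ Icc a b := fun s t => by
    change dotDir (linePt s φ t) φ ∈ Icc a b ↔ _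
    rw [dotDir_linePt]
  refine lintegral_congr fun s => ?_
  by_cases hs : s ∈ Icc a b
  · simp only [Set.indicator, hmem, hs, if_true, lineMass]
  · simp only [Set.indicator, hmem, hs, if_false, lintegral_zero]

/-! ### The discrete transform as an integral against a step weight -/

namespace Discretization

variable {A : AngularSet} (D : Discretization A)

/-- The angle and offset weights of the pixels, as a step function on the plane. -/
def stepWeight (c ψ : ℝ) (x : ℝ × ℝ) : ℝ :=
  ∑ i ∈ Finset.Icc 1 D.N, ∑ j ∈ Finset.Icc 1 D.M,
    (D.pixel i j).indicator (fun _ => hat D.δs (dotDir (D.center i j) ψ - c)) x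

lemma measurable_stepWeight (c ψ : ℝ) : Measurable (D.stepWeight c ψ) := by
  unfold stepWeight
  exact Finset.measurable_fun_sum _ fun i _ => Finset.measurable_fun_sum _ fun j _ =>
    measurable_const.indicator (D.measurableSet_pixel i j)

/-- Exactly one pixel contains a given point of the disk, and `y` is its centre. It is off by at
most `δx / 2` in each coordinate, and the sine and cosine are bounded by one. -/
lemma exists_stepWeight_eq (c ψ : ℝ) {x : ℝ × ℝ} (hx : x ∈ disk) :
    ∃ y, D.stepWeight c ψ x = hat D.δs (dotDir y ψ - c) ∧ |dotDir y ψ - dotDir x ψ| ≤ D.δx := by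
  have h := D.disk_cover hx
  simp only [mem_iUnion] at h
  obtain ⟨i, hi, j, hj, hxi, hxj⟩ := h
  have hne : ∀ i' j', (i' ≠ i ∨ j' ≠ j) → x ∉ D.pixel i' j' := by
    rintro i' j' h ⟨h1, h2⟩
    rcases h with h | h
    · exact h (cell_index_unique D.δx_pos h1 hxi)
    · exact h (cell_index_unique D.δx_pos h2 hxj)
  refine ⟨D.center i j, ?_, ?_⟩
  · rw [stepWeight, Finset.sum_eq_single_of_mem i hi, Finset.sum_eq_single_of_mem j hj]
    · exact indicator_of_mem (show x ∈ D.pixel i j from ⟨hxi, hxj⟩) _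
    · exact fun j' _ hj' => indicator_of_notMem (hne _ _ (.inr hj')) _
    · exact fun i' _ hi' => Finset.sum_eq_zero fun j' _ =>
        indicator_of_notMem (hne _ _ (.inl hi')) _
  · have h1 := abs_sub_gridPt_le hxi
    have h2 := abs_sub_gridPt_le hxj
    have e : dotDir (D.center i j) ψ - dotDir x ψ =
        -((x.1 - gridPt D.δx D.N i) * Real.cos ψ + (x.2 - gridPt D.δx D.M j) * Real.sin ψ) := by
      simp only [dotDir, center]; ring
    rw [e, abs_neg]
    refine (abs_add_le _ _).trans ?_
    rw [abs_mul, abs_mul]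
    nlinarith [Real.abs_cos_le_one ψ, Real.abs_sin_le_one ψ, abs_nonneg (Real.cos ψ),
      abs_nonneg (Real.sin ψ), abs_nonneg (x.1 - gridPt D.δx D.N i),
      abs_nonneg (x.2 - gridPt D.δx D.M j)]

lemma integral_mul_stepWeight (f : L2Disk) (c ψ : ℝ) :
    ∫ x, extDisk f x * D.stepWeight c ψ x = ∑ i ∈ Finset.Icc 1 D.N, ∑ j ∈ Finset.Icc 1 D.M,
      hat D.δs (dotDir (D.center i j) ψ - c) * ∫ x in D.pixel i j, extDisk f x := by
  have e : ∀ i j x, extDisk f x *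
      (D.pixel i j).indicator (fun _ => hat D.δs (dotDir (D.center i j) ψ - c)) x =
      (D.pixel i j).indicator
        (fun x => hat D.δs (dotDir (D.center i j) ψ - c) * extDisk f x) x := by
    intro i j x
    by_cases hx : x ∈ D.pixel i j <;> simp [hx, mul_comm]
  have hint : ∀ i j, Integrable ((D.pixel i j).indicator
      fun x => hat D.δs (dotDir (D.center i j) ψ - c) * extDisk f x) := fun i j =>
    ((integrable_extDisk f).const_mul _).indicator (D.measurableSet_pixel i j)
  simp only [stepWeight, Finset.mul_sum, e]
  rw [integral_finsetSum _ fun i _ => integrable_finsetSum _ fun j _ => hint i j]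
  refine Finset.sum_congr rfl fun i _ => ?_
  rw [integral_finsetSum _ fun j _ => hint i j]
  refine Finset.sum_congr rfl fun j _ => ?_
  rw [integral_indicator (D.measurableSet_pixel i j), integral_const_mul]

lemma integrable_mul_stepWeight (f : L2Disk) (c ψ : ℝ) :
    Integrable fun x => extDisk f x * D.stepWeight c ψ x := by
  have hb : ∀ x, ‖D.stepWeight c ψ x‖ ≤ ∑ i ∈ Finset.Icc 1 D.N, ∑ j ∈ Finset.Icc 1 D.M, D.δs := by
    intro x
    refine (norm_sum_le _ _).trans (Finset.sum_le_sum fun i _ => (norm_sum_le _ _).trans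
      (Finset.sum_le_sum fun j _ => (norm_indicator_le_norm_self _ _).trans ?_))
    rw [Real.norm_eq_abs, abs_of_nonneg (hat_nonneg _ _)]
    exact hat_le D.δs_pos.le _
  exact (integrable_extDisk f).mul_bdd (D.measurable_stepWeight c ψ).aestronglyMeasurable
    (.of_forall hb)

/-- The discrete transform on the sinogram pixel with centre `(c, ψ)`, against the averaged
Radon transform. -/
lemma enorm_stepWeight_sub_le (hη : D.δx + D.δφ ≤ D.δs) (f : L2Disk) {s φ ψ c : ℝ}
    (hc : |c - s| ≤ D.δs / 2) (hψ : ∀ x ∈ disk, |dotDir x ψ - dotDir x φ| ≤ D.δφ) :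
    ‖1 / D.δs ^ 2 * (∫ x, extDisk f x * D.stepWeight c ψ x) -
      1 / D.δs ^ 2 * ∫ x, extDisk f x * hat D.δs (dotDir x φ - c)‖ₑ ≤
      ENNReal.ofReal ((D.δx + D.δφ) / D.δs ^ 2) *
        ∫⁻ h in Icc (-(3 * D.δs)) (3 * D.δs), lineMass f (s + h, φ) := by
  have hδ := D.δs_pos
  have hx0 := D.δx_pos
  have hφ0 := D.δφ_nonneg
  have hd : Measurable fun x : ℝ × ℝ => dotDir x φ := by unfold dotDir; fun_prop
  have hS : MeasurableSet {x | dotDir x φ ∈ Icc (s - 3 * D.δs) (s + 3 * D.δs)} :=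
    hd measurableSet_Icc
  have hi2 : Integrable fun x => extDisk f x * hat D.δs (dotDir x φ - c) := by
    refine (integrable_extDisk f).mul_bdd (c := D.δs) ?_ (.of_forall fun x => ?_)
    · exact ((continuous_hat D.δs).measurable.comp (hd.sub_const _)).aestronglyMeasurable
    · rw [Real.norm_eq_abs, abs_of_nonneg (hat_nonneg _ _)]
      exact hat_le hδ.le _
  rw [← mul_sub, ← integral_sub (D.integrable_mul_stepWeight f c ψ) hi2, enorm_mul,
    Real.enorm_eq_ofReal (by positivity), div_eq_mul_one_div (D.δx + D.δφ), mul_comm (D.δx + D.δφ),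
    ENNReal.ofReal_mul (by positivity), mul_assoc]
  refine mul_le_mul_right ?_ _
  rw [← setLIntegral_Icc_shift (fun t => lineMass f (t, φ)), ← setLIntegral_extDisk_strip,
    ← lintegral_const_mul' _ _ ENNReal.ofReal_ne_top, ← lintegral_indicator hS]
  refine (enorm_integral_le_lintegral_enorm _).trans (lintegral_mono fun x => ?_)
  by_cases hx : x ∈ disk
  swap
  · simp [extDisk, hx]
  obtain ⟨y, hy, hyx⟩ := D.exists_stepWeight_eq c ψ hx
  have hyφ : |dotDir y ψ - dotDir x φ| ≤ D.δx + D.δφ :=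
    (abs_sub_le _ (dotDir x ψ) _).trans (add_le_add hyx (hψ x hx))
  rw [hy, ← mul_sub, enorm_mul, mul_comm]
  -- Within the strip the Lipschitz bound for the hat applies. Outside it both hats vanish: half a
  -- detector width and the perturbation `δx + δφ ≤ δs` use up at most `3δs / 2` of the distance
  -- `3δs`, which leaves more than the hat radius `δs`.
  by_cases hs : dotDir x φ ∈ Icc (s - 3 * D.δs) (s + 3 * D.δs)
  · rw [indicator_of_mem (by exact hs)]
    refine mul_le_mul_left ?_ _
    rw [Real.enorm_eq_ofReal_abs]
    refine ENNReal.ofReal_le_ofReal ((abs_hat_sub_le _ _ _).trans ?_)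
    rwa [sub_sub_sub_cancel_right]
  · have hfar : 3 * D.δs < |dotDir x φ - s| := by
      by_contra! h
      rw [abs_le] at h
      exact hs ⟨by linarith, by linarith⟩
    have h1 := abs_sub_le (dotDir x φ) c s
    have h2 := abs_sub_le (dotDir x φ) (dotDir y ψ) c
    rw [abs_sub_comm (dotDir x φ) (dotDir y ψ)] at h2
    rw [hat_eq_zero (by linarith), hat_eq_zero (by linarith), sub_zero, enorm_zero, zero_mul]
    exact zero_le

/-- The value of the discrete transform. -/
lemma radon_ae_eq (f : L2Disk) :
    ∀ᵐ z ∂(volume.restrict A.sino), ∃ ψ, (∀ x ∈ disk, |dotDir x ψ - dotDir x z.2| ≤ D.δφ) ∧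
      D.radon f z = 1 / D.δs ^ 2 *
        ∫ x, extDisk f x * D.stepWeight (cellCenter D.δs D.P z.1) ψ x := by
  filter_upwards [D.radon_coeFn f, ae_restrict_mem A.measurableSet_sino] with z hz hzs
  obtain ⟨k, q, hq, hkq, huniq, hψ⟩ := D.exists_angPixel hzs.2
  have h := D.offset_cover hzs.1
  simp only [mem_iUnion] at h
  obtain ⟨p, hp, hzp⟩ := h
  refine ⟨D.φ k q, hψ, ?_⟩
  rw [hz, Finset.sum_eq_single_of_mem p hp, Finset.sum_eq_single_of_mem k (Finset.mem_univ _),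
    Finset.sum_eq_single_of_mem q hq, indicator_of_mem (show z ∈ D.detector p ×ˢ D.angPixel k q from ⟨hzp, hkq⟩),
     integral_mul_stepWeight,
    cellCenter_eq D.δs_pos hzp]
  -- The prefactor `δx²` cancels the normalisation of the pixel means.
  · simp only [Pi.one_apply, one_mul, offset, Finset.mul_sum]
    refine Finset.sum_congr rfl fun i _ => Finset.sum_congr rfl fun j _ => ?_
    have := D.δx_pos.ne'
    field_simp
  · intro q' hq' hne
    rw [indicator_of_notMem, zero_mul]
    exact fun h => hne (huniq k q' hq' h.2).2
  · intro k' _ hne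
    refine Finset.sum_eq_zero fun q' hq' => ?_
    rw [indicator_of_notMem, zero_mul]
    exact fun h => hne (huniq k' q' hq' h.2).1
  · intro p' _ hne
    refine Finset.sum_eq_zero fun k' _ => Finset.sum_eq_zero fun q' _ => ?_
    rw [indicator_of_notMem, zero_mul]
    exact fun h => hne (cell_index_unique D.δs_pos h.1 hzp)

end Discretization

/-! ### Error bounds for a single discretization -/

/-- The Radon transform restricted to the angles of `𝒜`, as a function on the plane. -/
def radonExt (A : AngularSet) (f : L2Disk) : ℝ × ℝ → ℝ :=
  A.sino.indicator (lineIntegral (extDisk f))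

lemma measurable_radonExt (A : AngularSet) (f : L2Disk) : Measurable (radonExt A f) :=
  (stronglyMeasurable_lineIntegral f).measurable.indicator A.measurableSet_sino

lemma integrable_extSino {A : AngularSet} (g : L2Sino A) : Integrable (extSino g) :=
  (integrable_indicator_iff A.measurableSet_sino).2 ((Lp.memLp g).integrable (by norm_num))

lemma integrable_radonExt (A : AngularSet) (f : L2Disk) : Integrable (radonExt A f) :=
  (integrable_extSino (radon A f)).congr (extSino_radon_ae A f)

lemma memLp_radonExt (A : AngularSet) (f : L2Disk) : MemLp (radonExt A f) 2 :=
  (memLp_extSino (radon A f)).ae_eq (extSino_radon_ae A f)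

lemma lintegral_radonExt_sq (A : AngularSet) (f : L2Disk) :
    ∫⁻ z, ‖radonExt A f z‖ₑ ^ 2 = ‖radon A f‖ₑ ^ 2 := by
  rw [← lintegral_extSino_sq]
  refine lintegral_congr_ae ?_
  filter_upwards [extSino_radon_ae A f] with z hz
  rw [hz, radonExt]

/-- Near `s = ±1` the window of the kernel leaves the detector interval. This is harmless: at an
angle of `𝒜` the zero extension is still the full offset profile. -/
lemma averageDefect_radonExt {A : AngularSet} (f : L2Disk) {δ : ℝ} {κ : ℝ → ℝ → ℝ}
    (hκ : AveragingKernel δ κ) {z : ℝ × ℝ} (hz : z ∈ A.sino) :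
    averageDefect κ (radonExt A f) z =
      (∫ t, κ z.1 t * lineIntegral (extDisk f) (t, z.2)) - lineIntegral (extDisk f) z := by
  rw [← hκ.integral_mul_sub z.1 _ (integrable_lineIntegral f z.2), averageDefect]
  have h : ∀ t, radonExt A f (t, z.2) = lineIntegral (extDisk f) (t, z.2) := fun t => by
    rw [radonExt, sino_indicator_lineIntegral, indicator_of_mem hz.2]
  simp only [h]

lemma norm_le_of_lintegral_sq_le {α : Type*} [MeasurableSpace α] {μ : Measure α} {g : Lp ℝ 2 μ}
    {c : ℝ} (hc : 0 ≤ c) (h : ∫⁻ x, ‖g x‖ₑ ^ 2 ∂μ ≤ ENNReal.ofReal (c ^ 2)) : ‖g‖ ≤ c := by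
  rw [lintegral_enorm_sq_Lp, ← ofReal_norm, ← ENNReal.ofReal_pow (norm_nonneg _),
    ENNReal.ofReal_le_ofReal_iff (sq_nonneg _)] at h
  exact (pow_le_pow_iff_left₀ (norm_nonneg _) hc two_ne_zero).1 h

lemma shiftEnergy_le_of_modulus_le {A : AngularSet} {g : L2Sino A} {h m : ℝ}
    (hm : modulus g h ≤ m) : shiftEnergy (extSino g) h ≤ ENNReal.ofReal (m ^ 2) := by
  rw [← ofReal_modulus_sq]
  exact ENNReal.ofReal_le_ofReal (pow_le_pow_left₀ (Real.sqrt_nonneg _) hm 2)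

lemma lintegral_window_lineMass_le (A : AngularSet) (f : L2Disk) {r : ℝ} (hr : 0 ≤ r) :
    ∫⁻ z in A.sino, (∫⁻ h in Icc (-r) r, lineMass f (z.1 + h, z.2)) ^ 2 ≤
      ENNReal.ofReal ((8 * r * ‖f‖) ^ 2) := by
  let S : Set (ℝ × ℝ) := univ ×ˢ Ico (-Real.pi) Real.pi
  have hS : MeasurableSet S := MeasurableSet.univ.prod measurableSet_Ico
  -- The cutoff is in the angle only: it keeps the plane integral finite, while the offset stays
  -- free so that translation invariance can be used.
  let Φ : ℝ → ℝ × ℝ → ℝ≥0∞ := fun h z => S.indicator (fun z => lineMass f (z.1 + h, z.2)) z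
  have hW := measurable_lineMass f
  have hΦ : Measurable (Function.uncurry Φ) := by
    have : Function.uncurry Φ = (Prod.snd ⁻¹' S).indicator
        fun p : ℝ × ℝ × ℝ => lineMass f (p.2.1 + p.1, p.2.2) := rfl
    rw [this]
    exact Measurable.indicator (by fun_prop) (measurable_snd hS)
  have hm : ∀ h ∈ Icc (-r) r, ∫⁻ z, Φ h z ^ 2 ≤ ENNReal.ofReal (16 * ‖f‖ ^ 2) := by
    intro h _
    have h2 : 2 * ENNReal.ofReal (‖f‖ ^ 2) = ENNReal.ofReal (2 * ‖f‖ ^ 2) := by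
      rw [ENNReal.ofReal_mul (by norm_num)]; norm_num
    rw [lintegral_plane (hΦ.of_uncurry_left.pow_const 2)]
    calc ∫⁻ φ, ∫⁻ s, Φ h (s, φ) ^ 2
        ≤ ∫⁻ φ, (Ico (-Real.pi) Real.pi).indicator (fun _ => 2 * ‖f‖ₑ ^ 2) φ := by
          refine lintegral_mono fun φ => ?_
          by_cases hφ : φ ∈ Ico (-Real.pi) Real.pi
          · rw [indicator_of_mem hφ]
            refine le_trans (le_of_eq ?_) (lintegral_lineMass_sq_le f φ)
            rw [← lintegral_add_right_eq_self (fun s => lineMass f (s, φ) ^ 2) h]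
            refine lintegral_congr fun s => ?_
            have : (s, φ) ∈ S := ⟨mem_univ _, hφ⟩
            simp only [Φ, indicator_of_mem this]
          · have : ∀ s, (s, φ) ∉ S := fun s hs => hφ hs.2
            simp [Φ, this]
      _ ≤ ENNReal.ofReal (16 * ‖f‖ ^ 2) := by
          rw [lintegral_indicator measurableSet_Ico, setLIntegral_const, Real.volume_Ico,
            ← ofReal_norm, ← ENNReal.ofReal_pow (norm_nonneg _), h2,
            ← ENNReal.ofReal_mul (by positivity)]
          refine ENNReal.ofReal_le_ofReal ?_
          -- The chord bound 2 times the circle length `2π` is at most 16; a perfect square keeps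
          -- the final constant rational.
          nlinarith [Real.pi_le_four, sq_nonneg ‖f‖]
  calc ∫⁻ z in A.sino, (∫⁻ h in Icc (-r) r, lineMass f (z.1 + h, z.2)) ^ 2
      = ∫⁻ z in A.sino, (∫⁻ h in Icc (-r) r, Φ h z) ^ 2 := by
        refine setLIntegral_congr_fun A.measurableSet_sino fun z hz => ?_
        have : z ∈ S := ⟨mem_univ _, A.angles_subset hz.2⟩
        simp only [Φ, indicator_of_mem this]
    _ ≤ ∫⁻ z, (∫⁻ h in Icc (-r) r, Φ h z) ^ 2 := setLIntegral_le_lintegral _ _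
    _ ≤ ENNReal.ofReal (2 * r) ^ 2 * ENNReal.ofReal (16 * ‖f‖ ^ 2) := lintegral_window_sq_le hΦ hm
    _ = ENNReal.ofReal ((8 * r * ‖f‖) ^ 2) := by
        rw [← ENNReal.ofReal_pow (by positivity), ← ENNReal.ofReal_mul (by positivity)]
        congr 1; ring

namespace Discretization

variable {A : AngularSet} (D : Discretization A)

lemma averagingKernel : AveragingKernel D.δs (gridKernel D.δs D.P) :=
  averagingKernel_gridKernel D.δs_pos D.P

/-- The error of averaging the Radon transform with the detector kernel. -/
def averageError (f : L2Disk) : L2Sino A :=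
  ((D.averagingKernel.memLp_averageDefect D.δs_pos (measurable_radonExt A f)
    (memLp_radonExt A f)).restrict A.sino).toLp _

lemma averageError_coeFn (f : L2Disk) : D.averageError f =ᵐ[volume.restrict A.sino]
    averageDefect (gridKernel D.δs D.P) (radonExt A f) :=
  MemLp.coeFn_toLp _

/-- The consistency error of the discrete transform. -/
lemma norm_radon_sub_sub_averageError_le (hη : D.δx + D.δφ ≤ D.δs) (f : L2Disk) :
    ‖D.radon f - LimitedAngle.radon A f - D.averageError f‖ ≤
      24 * ((D.δx + D.δφ) / D.δs) * ‖f‖ := by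
  have hδ := D.δs_pos
  have hη0 : 0 ≤ D.δx + D.δφ := add_nonneg D.δx_pos.le D.δφ_nonneg
  refine norm_le_of_lintegral_sq_le (by positivity) ?_
  calc ∫⁻ z in A.sino, ‖(D.radon f - LimitedAngle.radon A f - D.averageError f : L2Sino A) z‖ₑ ^ 2
      ≤ ∫⁻ z in A.sino, ENNReal.ofReal ((D.δx + D.δφ) / D.δs ^ 2) ^ 2 *
        (∫⁻ h in Icc (-(3 * D.δs)) (3 * D.δs), lineMass f (z.1 + h, z.2)) ^ 2 := by
        refine lintegral_mono_ae ?_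
        filter_upwards [Lp.coeFn_sub (D.radon f - LimitedAngle.radon A f) (D.averageError f),
          Lp.coeFn_sub (D.radon f) (LimitedAngle.radon A f), D.averageError_coeFn f,
          LimitedAngle.radon_coeFn A f, D.radon_ae_eq f, ae_restrict_mem A.measurableSet_sino]
          with z h1 h2 h3 h4 ⟨ψ, hψ, h5⟩ hz
        rw [← mul_pow]
        refine pow_le_pow_left' ?_ 2
        -- The exact transform cancels, leaving the discrete transform minus the averaged one, both
        -- written as integrals of `f` against hats. The factor 24 is `8 · 3`, from the window
        -- radius `3 δs`.
        rw [h1, Pi.sub_apply, h2, Pi.sub_apply, h3, h4, h5,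
          averageDefect_radonExt f D.averagingKernel hz, integral_gridKernel_lineIntegral f hδ,
          sub_sub, add_sub_cancel]
        exact D.enorm_stepWeight_sub_le hη f (abs_cellCenter_sub_le hδ D.P z.1) hψ
    _ ≤ ENNReal.ofReal ((D.δx + D.δφ) / D.δs ^ 2) ^ 2 *
        ENNReal.ofReal ((8 * (3 * D.δs) * ‖f‖) ^ 2) := by
        rw [lintegral_const_mul' _ _ (by finiteness)]
        exact mul_le_mul_right (lintegral_window_lineMass_le A f (by positivity)) _
    _ = ENNReal.ofReal ((24 * ((D.δx + D.δφ) / D.δs) * ‖f‖) ^ 2) := by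
        rw [← ENNReal.ofReal_pow (by positivity), ← ENNReal.ofReal_mul (by positivity)]
        congr 1
        field_simp
        ring

/-- The error of the discrete transform in terms of the regularity of the Radon transform. -/
lemma norm_radon_sub_le (hη : D.δx + D.δφ ≤ D.δs) (f : L2Disk) {m : ℝ} (hm0 : 0 ≤ m)
    (hm : ∀ h, |h| ≤ 2 * D.δs → modulus (LimitedAngle.radon A f) h ≤ m) :
    ‖D.radon f - LimitedAngle.radon A f‖ ≤ 24 * ((D.δx + D.δφ) / D.δs) * ‖f‖ + 4 * m := by
  have h1 : ‖D.averageError f‖ ≤ 4 * m := by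
    refine norm_le_of_lintegral_sq_le (by positivity) ?_
    calc ∫⁻ z in A.sino, ‖D.averageError f z‖ₑ ^ 2
        = ∫⁻ z in A.sino, ‖averageDefect (gridKernel D.δs D.P) (radonExt A f) z‖ₑ ^ 2 := by
          refine lintegral_congr_ae ?_
          filter_upwards [D.averageError_coeFn f] with z hz
          rw [hz]
      _ ≤ ∫⁻ z, ‖averageDefect (gridKernel D.δs D.P) (radonExt A f) z‖ₑ ^ 2 :=
          setLIntegral_le_lintegral _ _
      _ ≤ 16 * ENNReal.ofReal (m ^ 2) := by
          refine D.averagingKernel.lintegral_averageDefect_le D.δs_pos (measurable_radonExt A f)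
            fun h hh => ?_
          rw [radonExt, ← shiftEnergy_congr (extSino_radon_ae A f)]
          exact shiftEnergy_le_of_modulus_le (hm h hh)
      _ = ENNReal.ofReal ((4 * m) ^ 2) := by
          rw [mul_pow, ENNReal.ofReal_mul (by positivity)]
          norm_num
  have h2 := D.norm_radon_sub_sub_averageError_le hη f
  have h3 := norm_add_le (D.radon f - LimitedAngle.radon A f - D.averageError f) (D.averageError f)
  rw [sub_add_cancel] at h3
  linarith

/-- Transposing the kernel puts the averaging defect on `g`, after which only the norm of the Radon
transform of `f` is needed. -/
lemma abs_inner_averageError_le (f : L2Disk) (g : L2Sino A) {m : ℝ} (hm0 : 0 ≤ m)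
    (hm : ∀ h, |h| ≤ 2 * D.δs → modulus g h ≤ m) :
    |inner ℝ g (D.averageError f)| ≤ ‖LimitedAngle.radon A f‖ * (4 * m) := by
  have e1 : inner ℝ g (D.averageError f) =
      ∫ z, extSino g z * averageDefect (gridKernel D.δs D.P) (radonExt A f) z := by
    rw [L2.inner_def]
    calc ∫ z in A.sino, inner ℝ (g z) (D.averageError f z)
        = ∫ z in A.sino, g z * averageDefect (gridKernel D.δs D.P) (radonExt A f) z := by
          refine integral_congr_ae ?_
          filter_upwards [D.averageError_coeFn f] with z hz
          rw [hz, real_inner_eq_re_inner, RCLike.inner_apply]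
          simp [mul_comm]
      _ = _ := by
          rw [← integral_indicator A.measurableSet_sino]
          refine integral_congr_ae (.of_forall fun z => ?_)
          simp only [extSino, ← indicator_mul_left]
  rw [e1, D.averagingKernel.integral_mul_averageDefect D.δs_pos (measurable_extSino g)
    (integrable_extSino g) (memLp_extSino g) (measurable_radonExt A f) (integrable_radonExt A f)
    (memLp_radonExt A f)]
  refine lintegral_mul_sq_le_L2 (measurable_radonExt A f).aestronglyMeasurable
    (D.averagingKernel.swap.stronglyMeasurable_averageDefect
      (measurable_extSino g)).aestronglyMeasurable (norm_nonneg _) (by positivity) ?_ ?_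
  · rw [lintegral_radonExt_sq, ← ofReal_norm, ENNReal.ofReal_pow (norm_nonneg _)]
  · refine (D.averagingKernel.swap.lintegral_averageDefect_le D.δs_pos (measurable_extSino g)
      fun h hh => shiftEnergy_le_of_modulus_le (hm h hh)).trans (le_of_eq ?_)
    rw [mul_pow, ENNReal.ofReal_mul (by positivity)]
    norm_num

/-- The error of the discrete backprojection in terms of the regularity of the data. -/
lemma norm_adjoint_radon_sub_le (hη : D.δx + D.δφ ≤ D.δs) (g : L2Sino A) {m : ℝ} (hm0 : 0 ≤ m)
    (hm : ∀ h, |h| ≤ 2 * D.δs → modulus g h ≤ m) :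
    ‖ContinuousLinearMap.adjoint D.radon g -
        ContinuousLinearMap.adjoint (LimitedAngle.radon A) g‖ ≤
      24 * ((D.δx + D.δφ) / D.δs) * ‖g‖ + 4 * ‖LimitedAngle.radon A‖ * m := by
  set f : L2Disk := ContinuousLinearMap.adjoint D.radon g -
    ContinuousLinearMap.adjoint (LimitedAngle.radon A) g with hf
  have hη0 : 0 ≤ (D.δx + D.δφ) / D.δs :=
    div_nonneg (add_nonneg D.δx_pos.le D.δφ_nonneg) D.δs_pos.le
  -- The error `f` is tested against itself: `‖f‖²` is the pairing of `g` with the forward error at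
  -- `f`. Both resulting bounds are linear in `‖f‖`, so one factor cancels at the end.
  have h1 : ‖f‖ ^ 2 = inner ℝ g (D.radon f - LimitedAngle.radon A f - D.averageError f) +
      inner ℝ g (D.averageError f) := by
    have h0 : inner ℝ f f = inner ℝ f (ContinuousLinearMap.adjoint D.radon g -
      ContinuousLinearMap.adjoint (LimitedAngle.radon A) g) := rfl
    rw [← inner_add_right, sub_add_cancel, ← real_inner_self_eq_norm_sq, h0, inner_sub_right,
      ContinuousLinearMap.adjoint_inner_right, ContinuousLinearMap.adjoint_inner_right,
      ← inner_sub_left, real_inner_comm]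
  have h2 := abs_real_inner_le_norm g (D.radon f - LimitedAngle.radon A f - D.averageError f)
  have h3 := D.norm_radon_sub_sub_averageError_le hη f
  have h4 := D.abs_inner_averageError_le f g hm0 hm
  have h5 := (LimitedAngle.radon A).le_opNorm f
  have h6 : ‖f‖ * ‖f‖ ≤ (24 * ((D.δx + D.δφ) / D.δs) * ‖g‖ +
      4 * ‖LimitedAngle.radon A‖ * m) * ‖f‖ := by
    have h7 := mul_le_mul_of_nonneg_left h3 (norm_nonneg g)
    have h8 := mul_le_mul_of_nonneg_right h5 (by positivity : 0 ≤ 4 * m)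
    have h9 := le_abs_self (inner ℝ g (D.radon f - LimitedAngle.radon A f - D.averageError f))
    have h10 := le_abs_self (inner ℝ g (D.averageError f))
    nlinarith
  rcases (norm_nonneg f).eq_or_lt with h0 | h0
  · rw [← h0]; positivity
  · exact le_of_mul_le_mul_right h6 h0

lemma opNorm_radon_sub_le (hη : D.δx + D.δφ ≤ D.δs) :
    ‖D.radon - LimitedAngle.radon A‖ ≤
      24 * ((D.δx + D.δφ) / D.δs) + 4 * √(16 * Real.pi * D.δs) := by
  have hη0 : 0 ≤ (D.δx + D.δφ) / D.δs :=
    div_nonneg (add_nonneg D.δx_pos.le D.δφ_nonneg) D.δs_pos.le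
  refine ContinuousLinearMap.opNorm_le_bound _ (by positivity) fun f => ?_
  -- The half-derivative bound at the largest admissible shift `2 δs` gives `√(16 π δs)`.
  have h := D.norm_radon_sub_le hη f (m := √(16 * Real.pi * D.δs) * ‖f‖) (by positivity)
    fun h hh => (modulus_radon_le A f h).trans ?_
  · rw [sub_apply]
    linarith
  · refine mul_le_mul_of_nonneg_right (Real.sqrt_le_sqrt ?_) (norm_nonneg _)
    nlinarith [Real.pi_pos]

end Discretization

/-! ### Asymptotics -/

section Asymptotics

variable {A : AngularSet} {J : Type*} {l : Filter J} {D : J → Discretization A}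

lemma tendsto_consistency (hφ : Tendsto (fun n => (D n).δφ / (D n).δs) l (𝓝 0))
    (hx : Tendsto (fun n => (D n).δx / (D n).δs) l (𝓝 0)) :
    Tendsto (fun n => ((D n).δx + (D n).δφ) / (D n).δs) l (𝓝 0) := by
  simpa [add_div] using hx.add hφ

lemma eventually_le_of_tendsto_consistency
    (h : Tendsto (fun n => ((D n).δx + (D n).δφ) / (D n).δs) l (𝓝 0)) :
    ∀ᶠ n in l, (D n).δx + (D n).δφ ≤ (D n).δs := by
  filter_upwards [h.eventually_le_const one_pos] with n hn
  rwa [div_le_one (D n).δs_pos] at hn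

lemma isBigO_consistency {ε : ℝ}
    (hφ : (fun n => (D n).δφ) =O[l] fun n => (D n).δs ^ (1 + ε))
    (hx : (fun n => (D n).δx) =O[l] fun n => (D n).δs ^ (1 + ε)) :
    (fun n => ((D n).δx + (D n).δφ) / (D n).δs) =O[l] fun n => (D n).δs ^ ε := by
  have h := (hx.add hφ).mul (isBigO_refl (fun n => ((D n).δs)⁻¹) l)
  refine h.congr (fun n => (div_eq_mul_inv _ _).symm) fun n => ?_
  have := (D n).δs_pos
  rw [Real.rpow_add this, Real.rpow_one]
  field_simp

lemma tendsto_rpow_width (hs : Tendsto (fun n => (D n).δs) l (𝓝 0)) {ε : ℝ} (hε : 0 < ε) :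
    Tendsto (fun n => (D n).δs ^ ε) l (𝓝 0) := by
  have := hs.rpow_const (p := ε) (.inr hε.le)
  rwa [Real.zero_rpow hε.ne'] at this

lemma eventually_modulus_le (hs : Tendsto (fun n => (D n).δs) l (𝓝 0)) {g : L2Sino A} {ε : ℝ}
    (hε : 0 < ε) (hg : (fun h : ℝ => modulus g h) =O[𝓝 0] fun h : ℝ => |h| ^ ε) :
    ∃ C ≥ 0, ∀ᶠ n in l, ∀ h, |h| ≤ 2 * (D n).δs → modulus g h ≤ C * (D n).δs ^ ε := by
  obtain ⟨C, hC, hb⟩ := hg.exists_nonneg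
  obtain ⟨r, hr, hball⟩ := Metric.eventually_nhds_iff.1 hb.bound
  refine ⟨C * 2 ^ ε, by positivity, ?_⟩
  -- Once `2 δs < r`, every relevant shift lies where the order bound holds; monotonicity of the
  -- power produces the constant `2 ^ ε`.
  filter_upwards [hs.eventually_lt_const (half_pos hr)] with n hn h hh
  have h1 := hball (y := h) (by rw [dist_zero_right, Real.norm_eq_abs]; linarith)
  rw [Real.norm_of_nonneg (by positivity : 0 ≤ |h| ^ ε)] at h1
  refine (le_abs_self _).trans (h1.trans ?_)
  rw [mul_assoc, ← Real.mul_rpow (by norm_num) (D n).δs_pos.le]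
  exact mul_le_mul_of_nonneg_left (Real.rpow_le_rpow (abs_nonneg _) hh hε.le) hC

lemma isBigO_of_error_le {ε a b : ℝ} {x : J → ℝ} (hx0 : ∀ n, 0 ≤ x n)
    (hc : (fun n => ((D n).δx + (D n).δφ) / (D n).δs) =O[l] fun n => (D n).δs ^ ε)
    (hx : ∀ᶠ n in l, x n ≤ a * (((D n).δx + (D n).δφ) / (D n).δs) + b * (D n).δs ^ ε) :
    x =O[l] fun n => (D n).δs ^ ε := by
  refine IsBigO.trans (IsBigO.of_bound' ?_) ((hc.const_mul_left a).add
    ((isBigO_refl (fun n => (D n).δs ^ ε) l).const_mul_left b))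
  filter_upwards [hx] with n hn
  rw [Real.norm_of_nonneg (hx0 n)]
  exact hn.trans (le_abs_self _)

lemma tendsto_opNorm_radon_sub (hs : Tendsto (fun n => (D n).δs) l (𝓝 0))
    (hφ : Tendsto (fun n => (D n).δφ / (D n).δs) l (𝓝 0))
    (hx : Tendsto (fun n => (D n).δx / (D n).δs) l (𝓝 0)) :
    Tendsto (fun n => ‖(D n).radon - radon A‖) l (𝓝 0) := by
  have hc := tendsto_consistency hφ hx
  have hlim : Tendsto (fun n => 24 * (((D n).δx + (D n).δφ) / (D n).δs) +
      4 * √(16 * Real.pi * (D n).δs)) l (𝓝 0) := by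
    have h1 := (hs.const_mul (16 * Real.pi)).sqrt
    simpa using (hc.const_mul 24).add (h1.const_mul 4)
  refine tendsto_of_tendsto_of_tendsto_of_le_of_le' tendsto_const_nhds hlim
    (.of_forall fun n => norm_nonneg _) ?_
  filter_upwards [eventually_le_of_tendsto_consistency hc] with n hn
  exact (D n).opNorm_radon_sub_le hn

lemma isBigO_opNorm_radon_sub (hs : Tendsto (fun n => (D n).δs) l (𝓝 0)) {ε : ℝ} (hε : 0 < ε)
    (hε2 : ε ≤ 1 / 2) (hφ : (fun n => (D n).δφ) =O[l] fun n => (D n).δs ^ (1 + ε))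
    (hx : (fun n => (D n).δx) =O[l] fun n => (D n).δs ^ (1 + ε)) :
    (fun n => ‖(D n).radon - radon A‖) =O[l] fun n => (D n).δs ^ ε := by
  have hc := isBigO_consistency hφ hx
  refine isBigO_of_error_le (a := 24) (b := 4 * √(16 * Real.pi)) (fun n => norm_nonneg _) hc ?_
  filter_upwards [eventually_le_of_tendsto_consistency (hc.trans_tendsto (tendsto_rpow_width hs hε)),
    hs.eventually_le_const one_pos] with n hn h1
  refine ((D n).opNorm_radon_sub_le hn).trans ?_
  rw [Real.sqrt_mul (by positivity), Real.sqrt_eq_rpow (D n).δs, ← mul_assoc]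
  -- The averaging term is of order `δs ^ (1/2)`, which is at most `δs ^ ε` once `δs ≤ 1`, since `ε
  -- ≤ 1/2`.
  exact add_le_add le_rfl (mul_le_mul_of_nonneg_left
    (Real.rpow_le_rpow_of_exponent_ge (D n).δs_pos h1 hε2) (by positivity))

/-- Taking adjoints is an additive isometry, so the operator-norm statements for the backprojection
reduce to those for the forward transform. -/
lemma norm_adjoint_sub_adjoint (D : Discretization A) :
    ‖ContinuousLinearMap.adjoint D.radon - ContinuousLinearMap.adjoint (radon A)‖ =
      ‖D.radon - radon A‖ := by
  rw [← map_sub, LinearIsometryEquiv.norm_map]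

lemma isBigO_norm_radon_sub (hs : Tendsto (fun n => (D n).δs) l (𝓝 0)) (f : L2Disk) {ε : ℝ}
    (hε : 0 < ε) (hf : (fun h : ℝ => modulus (radon A f) h) =O[𝓝 0] fun h : ℝ => |h| ^ ε)
    (hφ : (fun n => (D n).δφ) =O[l] fun n => (D n).δs ^ (1 + ε))
    (hx : (fun n => (D n).δx) =O[l] fun n => (D n).δs ^ (1 + ε)) :
    (fun n => ‖(D n).radon f - radon A f‖) =O[l] fun n => (D n).δs ^ ε := by
  have hc := isBigO_consistency hφ hx
  obtain ⟨C, hC, hm⟩ := eventually_modulus_le hs hε hf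
  refine isBigO_of_error_le (a := 24 * ‖f‖) (b := 4 * C) (fun n => norm_nonneg _) hc ?_
  filter_upwards [eventually_le_of_tendsto_consistency (hc.trans_tendsto (tendsto_rpow_width hs hε)),
    hm] with n hn hm
  have h0 : 0 ≤ (D n).δs ^ ε := Real.rpow_nonneg (D n).δs_pos.le _
  linarith [(D n).norm_radon_sub_le hn f (by positivity) hm]

lemma isBigO_norm_adjoint_radon_sub (hs : Tendsto (fun n => (D n).δs) l (𝓝 0)) (g : L2Sino A)
    {ε : ℝ} (hε : 0 < ε) (hg : (fun h : ℝ => modulus g h) =O[𝓝 0] fun h : ℝ => |h| ^ ε)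
    (hφ : (fun n => (D n).δφ) =O[l] fun n => (D n).δs ^ (1 + ε))
    (hx : (fun n => (D n).δx) =O[l] fun n => (D n).δs ^ (1 + ε)) :
    (fun n => ‖ContinuousLinearMap.adjoint (D n).radon g -
      ContinuousLinearMap.adjoint (radon A) g‖) =O[l] fun n => (D n).δs ^ ε := by
  have hc := isBigO_consistency hφ hx
  obtain ⟨C, hC, hm⟩ := eventually_modulus_le hs hε hg
  refine isBigO_of_error_le (a := 24 * ‖g‖) (b := 4 * ‖radon A‖ * C) (fun n => norm_nonneg _) hc ?_
  filter_upwards [eventually_le_of_tendsto_consistency (hc.trans_tendsto (tendsto_rpow_width hs hε)),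
    hm] with n hn hm
  have h0 : 0 ≤ (D n).δs ^ ε := Real.rpow_nonneg (D n).δs_pos.le _
  linarith [(D n).norm_adjoint_radon_sub_le hn g (by positivity) hm]

end Asymptotics

end LimitedAngle

end

open LimitedAngle in
theorem theorem2p10 (A : AngularSet) {J : Type*} (l : Filter J) (D : J → Discretization A)
    (hs : Tendsto (fun n => (D n).δs) l (𝓝 0)) :
    -- convergence and rates in operator norm for the limited-angle Radon transform
    (Tendsto (fun n => (D n).δφ / (D n).δs) l (𝓝 0) →
      Tendsto (fun n => (D n).δx / (D n).δs) l (𝓝 0) →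
      Tendsto (fun n => ‖(D n).radon - radon A‖) l (𝓝 0)) ∧
    (∀ ε : ℝ, 0 < ε → ε ≤ 1 / 2 →
      (fun n => (D n).δφ) =O[l] (fun n => (D n).δs ^ (1 + ε)) →
      (fun n => (D n).δx) =O[l] (fun n => (D n).δs ^ (1 + ε)) →
      (fun n => ‖(D n).radon - radon A‖) =O[l] (fun n => (D n).δs ^ ε)) ∧
    -- convergence and rates in operator norm for the limited-angle backprojection
    (Tendsto (fun n => (D n).δφ / (D n).δs) l (𝓝 0) →
      Tendsto (fun n => (D n).δx / (D n).δs) l (𝓝 0) →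
      Tendsto (fun n => ‖ContinuousLinearMap.adjoint (D n).radon -
        ContinuousLinearMap.adjoint (radon A)‖) l (𝓝 0)) ∧
    (∀ ε : ℝ, 0 < ε → ε ≤ 1 / 2 →
      (fun n => (D n).δφ) =O[l] (fun n => (D n).δs ^ (1 + ε)) →
      (fun n => (D n).δx) =O[l] (fun n => (D n).δs ^ (1 + ε)) →
      (fun n => ‖ContinuousLinearMap.adjoint (D n).radon -
        ContinuousLinearMap.adjoint (radon A)‖) =O[l] (fun n => (D n).δs ^ ε)) ∧
    -- rates for individual functions of higher regularity
    (∀ (f : L2Disk) (ε : ℝ), 0 < ε →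
      (fun h : ℝ => modulus (radon A f) h) =O[𝓝 0] (fun h : ℝ => |h| ^ ε) →
      (fun n => (D n).δφ) =O[l] (fun n => (D n).δs ^ (1 + ε)) →
      (fun n => (D n).δx) =O[l] (fun n => (D n).δs ^ (1 + ε)) →
      (fun n => ‖(D n).radon f - radon A f‖) =O[l] (fun n => (D n).δs ^ ε)) ∧
    (∀ (g : L2Sino A) (ε : ℝ), 0 < ε →
      (fun h : ℝ => modulus g h) =O[𝓝 0] (fun h : ℝ => |h| ^ ε) →
      (fun n => (D n).δφ) =O[l] (fun n => (D n).δs ^ (1 + ε)) →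
      (fun n => (D n).δx) =O[l] (fun n => (D n).δs ^ (1 + ε)) →
      (fun n => ‖ContinuousLinearMap.adjoint (D n).radon g -
        ContinuousLinearMap.adjoint (radon A) g‖) =O[l] (fun n => (D n).δs ^ ε)) := by
  refine ⟨tendsto_opNorm_radon_sub hs, fun ε hε hε2 => isBigO_opNorm_radon_sub hs hε hε2, ?_, ?_,
    fun f ε hε => isBigO_norm_radon_sub hs f hε, fun g ε hε => isBigO_norm_adjoint_radon_sub hs g hε⟩
  · simp only [norm_adjoint_sub_adjoint]
    exact tendsto_opNorm_radon_sub hs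
  · simp only [norm_adjoint_sub_adjoint]
    exact fun ε hε hε2 => isBigO_opNorm_radon_sub hs hε hε2
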